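/- Let $(X,d)$ be a geodesic metric space, i.e. for all $x,y\in X$ there is an isometric embedding $[0,d(x,y)]\to X$ with $0\mapsto x$ and $d(x,y)\mapsto y$. For $r>0$ let $\operatorname{Rips}(X,r)$ be (the geometric realization, with the weak topology, of) the open Vietoris–Rips complex: its vertex set is $X$ and its simplices are the nonempty finite subsets $\sigma\subseteq X$ with $\operatorname{Diam}(\sigma)<r$. For $p\le q$ let $i_{p,q}\colon \operatorname{Rips}(X,p)\to\operatorname{Rips}(X,q)$ be the inclusion. For $\bullet\in X$ and $s>0$ let $\mathcal D(X,s,\pi_1)\le \pi_1(X,\bullet)$ be the subgroup generated by the classes of all lassos $\alpha*\beta*\alpha^-$, where $\alpha$ is a path in $X$ starting at $\bullet$ and $\beta$ is a loop based at the endpoint of $\alpha$ with $\operatorname{Diam}(\beta)<s$; it is a normal subgroup. For an abelian group $G$ let $\mathcal D(X,s,G)\le H_1(X;G)$ (singular homology) be the subgroup generated by the classes of the cycles $g\cdot\beta$, where $g\in G$ and $\beta$ is a loop in $X$ with $\operatorname{Diam}(\beta)<s$. **Theorem (Persistence–diameter correspondence).** Let $X$ be a geodesic space. 1. For every $\bullet\in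 X$ there are group isomorphisms $$f_r\colon \pi_1(\operatorname{Rips}(X,r),\bullet)\xrightarrow{\ \cong\ }\pi_1(X,\bullet)/\mathcal D(X,\tfrac{3r}{2},\pi_1)\qquad(r>0)$$ which commute with the structure maps: for all $0<p\le q$, $f_q\circ\pi_1(i_{p,q})$ equals $f_p$ followed by the quotient map $\pi_1(X,\bullet)/\mathcal D(X,\tfrac{3p}{2},\pi_1)\to\pi_1(X,\bullet)/\mathcal D(X,\tfrac{3q}{2},\pi_1)$. 2. For every abelian group $G$ there are group isomorphisms $$h_r\colon H_1(\operatorname{Rips}(X,r);G)\xrightarrow{\ \cong\ }H_1(X;G)/\mathcal D(X,\tfrac{3r}{2},G)\qquad(r>0)$$ which commute with the structure maps: for all $0<p\le q$, $h_q\circ H_1(i_{p,q};G)$ equals $h_p$ followed by the quotient map $H_1(X;G)/\mathcal D(X,\tfrac{3p}{2},G)\to H_1(X;G)/\mathcal D(X,\tfrac{3q}{2},G)$. -/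

import Mathlib

universe u

namespace RipsPersistence

open CategoryTheory AlgebraicTopology

/-- A metric space is geodesic if any two points `x`, `y` are joined by an isometric embedding
of the interval `[0, dist x y]` that starts in `x` and ends in `y`. -/
def IsGeodesicSpace (X : Type u) [MetricSpace X] : Prop :=
  ∀ x y : X, ∃ γ : ℝ → X, γ 0 = x ∧ γ (dist x y) = y ∧
    ∀ s ∈ Set.Icc 0 (dist x y), ∀ t ∈ Set.Icc 0 (dist x y), dist (γ s) (γ t) = |s - t|

section Realization

variable {V : Type u}

/-- The points of the geometric realization of an abstract simplicial complex `K`: families of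
barycentric coordinates supported on a simplex of `K`. -/
@[ext]
structure Realization (K : AbstractSimplicialComplex V) : Type u where
  /-- the barycentric coordinates -/
  coord : V → ℝ
  nonneg : ∀ v, 0 ≤ coord v
  exists_face : ∃ σ ∈ K.faces, (∀ v, v ∉ σ → coord v = 0) ∧ ∑ v ∈ σ, coord v = 1

open Classical in
/-- The inclusion of the closed simplex spanned by a face `σ` of `K` into the realization. -/
noncomputable def Realization.face (K : AbstractSimplicialComplex V) (σ : K.faces)
    (s : stdSimplex ℝ (σ.1 : Finset V)) : Realization K where
  coord v := if h : v ∈ σ.1 then s.1 ⟨v, h⟩ else 0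
  nonneg v := by
    by_cases h : v ∈ σ.1
    · simpa [h] using s.2.1 ⟨v, h⟩
    · simp [h]
  exists_face := by
    refine ⟨σ.1, σ.2, fun v hv => by simp [hv], ?_⟩
    rw [← Finset.sum_coe_sort]
    simpa using s.2.2

/-- The weak topology: the finest one for which the inclusions of all closed simplices, with
their Euclidean topology, are continuous. -/
noncomputable instance (K : AbstractSimplicialComplex V) : TopologicalSpace (Realization K) :=
  ⨆ σ : K.faces, TopologicalSpace.coinduced (Realization.face K σ) inferInstance

theorem Realization.continuous_face (K : AbstractSimplicialComplex V) (σ : K.faces) :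
    Continuous (Realization.face K σ) :=
  continuous_iff_coinduced_le.2
    (le_iSup (fun σ : K.faces =>
      TopologicalSpace.coinduced (Realization.face K σ) inferInstance) σ)

theorem Realization.continuous_iff {K : AbstractSimplicialComplex V} {Y : Type*}
    [TopologicalSpace Y] (f : Realization K → Y) :
    Continuous f ↔ ∀ σ : K.faces, Continuous (f ∘ Realization.face K σ) := by
  constructor
  · intro hf σ
    exact hf.comp (Realization.continuous_face K σ)
  · intro h
    rw [continuous_iSup_dom]
    intro σ
    exact continuous_coinduced_dom.2 (h σ)

open Classical in
/-- A vertex of the complex, as a point of the realization. -/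
noncomputable def Realization.vertex (K : AbstractSimplicialComplex V) (v : V) : Realization K where
  coord w := if w = v then 1 else 0
  nonneg w := by split_ifs <;> norm_num
  exists_face := ⟨{v}, K.singleton_mem v, fun w hw => by simpa using hw, by simp⟩

/-- The map of realizations induced by the inclusion of a subcomplex. -/
noncomputable def Realization.incl {K L : AbstractSimplicialComplex V} (h : K ≤ L) :
    C(Realization K, Realization L) where
  toFun t :=
    { coord := t.coord
      nonneg := t.nonneg
      exists_face := by
        obtain ⟨σ, hσ, h'⟩ := t.exists_face
        exact ⟨σ, h hσ, h'⟩ }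
  continuous_toFun := by
    rw [Realization.continuous_iff]
    intro σ
    exact Realization.continuous_face L ⟨σ.1, h σ.2⟩

/-- The homomorphism of fundamental groups induced by the inclusion of a subcomplex; the base
point is a vertex of the smaller complex, and the inclusion fixes it. -/
noncomputable def piOneIncl {K L : AbstractSimplicialComplex V} (h : K ≤ L) (v : V) :
    FundamentalGroup (Realization K) (Realization.vertex K v) →*
      FundamentalGroup (Realization L) (Realization.vertex L v) :=
  FundamentalGroup.map (Realization.incl h) (Realization.vertex K v)

end Realization

/-- The open Vietoris-Rips complex at scale `r`: the simplices are the nonempty finite subsets of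
`X` of diameter less than `r`. -/
def rips (X : Type u) [MetricSpace X] (r : Set.Ioi (0 : ℝ)) : AbstractSimplicialComplex X where
  faces := {σ | σ.Nonempty ∧ Metric.diam (σ : Set X) < r.1}
  isRelLowerSet_faces := by
    rintro σ ⟨hσ, hd⟩
    refine ⟨hσ, fun τ hτ hne => ⟨hne, lt_of_le_of_lt ?_ hd⟩⟩
    exact Metric.diam_mono (Finset.coe_subset.2 hτ) σ.finite_toSet.isBounded
  singleton_mem v := ⟨Finset.singleton_nonempty v, by
    have h : (0 : ℝ) < r.1 := r.2
    simpa only [Finset.coe_singleton, Metric.diam_singleton] using h⟩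

theorem rips_mono {X : Type u} [MetricSpace X] {p q : Set.Ioi (0 : ℝ)} (h : p ≤ q) :
    rips X p ≤ rips X q :=
  fun _ hσ => ⟨hσ.1, lt_of_lt_of_le hσ.2 h⟩

section PiOne

variable {X : Type u} [MetricSpace X]

/-- The subgroup of `π₁(X, x₀)` generated by the lassos `α * β * α⁻`, where `α` is a path starting
at `x₀` and `β` is a loop, based at the end point of `α`, of diameter less than `d`. -/
noncomputable def diamPiOne (x₀ : X) (d : ℝ) : Subgroup (FundamentalGroup X x₀) :=
  Subgroup.closure {γ | ∃ (x : X) (α : Path x₀ x) (β : Path x x),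
    Metric.diam (Set.range β) < d ∧
      γ = FundamentalGroup.fromPath (Path.Homotopic.Quotient.mk ((α.trans β).trans α.symm))}

theorem diamPiOne_mono (x₀ : X) {c d : ℝ} (h : c ≤ d) : diamPiOne x₀ c ≤ diamPiOne x₀ d := by
  apply Subgroup.closure_mono
  rintro γ ⟨x, α, β, hβ, rfl⟩
  exact ⟨x, α, β, lt_of_lt_of_le hβ h, rfl⟩

instance diamPiOne_normal (x₀ : X) (d : ℝ) : (diamPiOne x₀ d).Normal := by
  have key : ∀ (x : X) (α : Path x₀ x) (β : Path x x), Metric.diam (Set.range β) < d →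
      ∀ g : FundamentalGroup X x₀, g * FundamentalGroup.fromPath
        (Path.Homotopic.Quotient.mk ((α.trans β).trans α.symm)) * g⁻¹ ∈ diamPiOne x₀ d := by
    intro x α β hβ g
    obtain ⟨δ, hδ⟩ := Path.Homotopic.Quotient.mk_surjective
      (FundamentalGroup.toPath (g⁻¹))
    have hg : (g : Path.Homotopic.Quotient x₀ x₀) =
        (Path.Homotopic.Quotient.mk δ).symm := by
      rw [hδ]
      exact (inv_inv g).symm
    refine Subgroup.subset_closure ⟨x, δ.trans α, β, hβ, ?_⟩
    rw [FundamentalGroup.mul_def, FundamentalGroup.mul_def]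
    change Path.Homotopic.Quotient.trans (FundamentalGroup.toPath (g⁻¹)) _ = _
    rw [← hδ, hg]
    simp only [FundamentalGroup.fromPath, FundamentalGroup.fromArrow, Path.trans_symm,
      Path.Homotopic.Quotient.mk_trans, Path.Homotopic.Quotient.mk_symm,
      Path.Homotopic.Quotient.trans_assoc]
  constructor
  intro n hn g
  induction hn using Subgroup.closure_induction with
  | mem γ hγ =>
    obtain ⟨x, α, β, hβ, rfl⟩ := hγ
    exact key x α β hβ g
  | one => simpa using (diamPiOne x₀ d).one_mem
  | mul a b _ _ iha ihb =>
    have := (diamPiOne x₀ d).mul_mem iha ihb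
    rwa [conj_mul] at this
  | inv a _ iha =>
    have := (diamPiOne x₀ d).inv_mem iha
    rwa [conj_inv] at this

/-- The projection `π₁(X, x₀) / D(c) → π₁(X, x₀) / D(d)` for `c ≤ d`. -/
noncomputable def diamPiOneProj (x₀ : X) {c d : ℝ} (h : c ≤ d) :
    FundamentalGroup X x₀ ⧸ diamPiOne x₀ c →* FundamentalGroup X x₀ ⧸ diamPiOne x₀ d :=
  QuotientGroup.map _ _ (MonoidHom.id _) (diamPiOne_mono x₀ h)

end PiOne

section HOne

open scoped Simplicial

/-- The first singular homology group of a space with coefficients in an abelian group. -/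
noncomputable abbrev HOne (G : Type u) [AddCommGroup G] (Y : Type u) [TopologicalSpace Y] :
    AddCommGrpCat.{u} :=
  ((singularHomologyFunctor AddCommGrpCat.{u} 1).obj (AddCommGrpCat.of G)).obj (TopCat.of Y)

/-- The homomorphism in first homology induced by a continuous map. -/
noncomputable def hOneMap (G : Type u) [AddCommGroup G] {Y Z : Type u} [TopologicalSpace Y]
    [TopologicalSpace Z] (f : C(Y, Z)) : HOne G Y →+ HOne G Z :=
  (((singularHomologyFunctor AddCommGrpCat.{u} 1).obj (AddCommGrpCat.of G)).map
    (TopCat.ofHom f)).hom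

variable {X : Type u} [TopologicalSpace X]

/-- A path, regarded as a singular 1-simplex. -/
noncomputable def pathSimplex {x y : X} (β : Path x y) : (TopCat.toSSet.obj (TopCat.of X)) _⦋1⦌ :=
  (TopCat.toSSetObjEquiv (TopCat.of X) (Opposite.op ⦋1⦌)).symm
    (β.toContinuousMap.comp ⟨stdSimplexHomeomorphUnitInterval,
      stdSimplexHomeomorphUnitInterval.continuous⟩)

theorem delta_pathSimplex {x : X} (β : Path x x) (i : Fin 2) :
    (TopCat.toSSet.obj (TopCat.of X)).δ i (pathSimplex β) = TopCat.toSSetObj₀Equiv.symm x := by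
  apply TopCat.toSSetObj₀Equiv.injective
  rw [Equiv.apply_symm_apply]
  have h : TopCat.toSSetObj₀Equiv ((TopCat.toSSet.obj (TopCat.of X)).δ i (pathSimplex β)) =
      β (stdSimplexHomeomorphUnitInterval
        (stdSimplex.map i.succAbove (stdSimplex.vertex (0 : Fin 1)))) := by
    rw [← Subsingleton.elim (default : stdSimplex ℝ (Fin 1)) (stdSimplex.vertex 0)]
    rfl
  rw [h, stdSimplex.map_vertex]
  fin_cases i
  · exact β.target
  · exact β.source

/-- For a loop `β`, the 1-chains `g • β` are cycles. -/
theorem loop_isCycle (G : Type u) [AddCommGroup G] {x : X} (β : Path x x) :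
    SSet.ιChainComplex (TopCat.toSSet.obj (TopCat.of X)) (R := AddCommGrpCat.of G) (pathSimplex β) ≫
      (((singularChainComplexFunctor AddCommGrpCat.{u}).obj (AddCommGrpCat.of G)).obj
        (TopCat.of X)).d 1 0 = 0 := by
  refine (SSet.ιChainComplex_d (TopCat.toSSet.obj (TopCat.of X)) (AddCommGrpCat.of G)
    (n := 0) (pathSimplex β)).trans ?_
  simp [Fin.sum_univ_two, delta_pathSimplex]
  rfl

/-- The homomorphism `G → H₁(X; G)` that sends `g` to the homology class of the cycle `g • β`. -/
noncomputable def loopClass (G : Type u) [AddCommGroup G] {x : X} (β : Path x x) :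
    G →+ HOne G X :=
  (HomologicalComplex.liftCycles
      (((singularChainComplexFunctor AddCommGrpCat.{u}).obj (AddCommGrpCat.of G)).obj
        (TopCat.of X))
      (SSet.ιChainComplex (TopCat.toSSet.obj (TopCat.of X)) (R := AddCommGrpCat.of G)
        (pathSimplex β)) 0 (by simp) (loop_isCycle G β) ≫
    HomologicalComplex.homologyπ _ 1).hom

end HOne

section DiamHOne

variable (X : Type u) [MetricSpace X] (G : Type u) [AddCommGroup G]

/-- The subgroup of `H₁(X; G)` generated by the classes of the cycles `g • β`, where `g ∈ G` and
`β` is a loop in `X` of diameter less than `d`. -/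
noncomputable def diamHOne (d : ℝ) : AddSubgroup (HOne G X) :=
  AddSubgroup.closure {c | ∃ (x : X) (β : Path x x) (g : G),
    Metric.diam (Set.range β) < d ∧ c = loopClass G β g}

theorem diamHOne_mono {c d : ℝ} (h : c ≤ d) : diamHOne X G c ≤ diamHOne X G d := by
  apply AddSubgroup.closure_mono
  rintro γ ⟨x, β, g, hβ, rfl⟩
  exact ⟨x, β, g, lt_of_lt_of_le hβ h, rfl⟩

/-- The projection `H₁(X; G) / D(c) → H₁(X; G) / D(d)` for `c ≤ d`. -/
noncomputable def diamHOneProj {c d : ℝ} (h : c ≤ d) :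
    HOne G X ⧸ diamHOne X G c →+ HOne G X ⧸ diamHOne X G d :=
  QuotientAddGroup.map _ _ (AddMonoidHom.id _) (diamHOne_mono X G h)

end DiamHOne

theorem scale_mono {p q : Set.Ioi (0 : ℝ)} (h : p ≤ q) : 3 * p.1 / 2 ≤ 3 * q.1 / 2 := by
  have h' : p.1 ≤ q.1 := h
  linarith

end RipsPersistence

/-!
A function of pairs of nearby points of a space that satisfies the cocycle identity is the gluing
datum of a covering space, whose monodromy is a functor on the fundamental groupoid. Sending a short
path in `X` to the edge between its end points is such a datum, so it defines a functor from the
fundamental groupoid of `X` to that of `Rips(X, r)`. Every path in the Rips complex is a composite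
of edge paths and every edge is the image of a geodesic, so on fundamental groups and on first
homology the induced homomorphism is surjective.

The constant `3/2` arises twice. The functor kills every loop in a ball of radius `3r/2`: a point
`x` of the ball is joined to the centre `z` by the edges `z, m, x` with `m` two thirds of the way
from `z` to `x`, the resulting arrow does not depend on the choice of `m`, and these arrows form a
cone over the ball. Conversely, a geodesic triangle has diameter at most half its perimeter, which
is less than `3r/2` if the sides are shorter than `r`. A functor from the fundamental groupoid of
`X` to a group that kills the loops of diameter less than `3r/2` is therefore a cocycle on the edges
of `Rips(X, r)` and factors through the Rips complex.

Homomorphisms from `H₁(Y; G)` to an abelian group `A` are cocycles on the fundamental groupoid of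
`Y` with values in `Hom(G, A)`, compared by their values on loops; in this form the same functor
computes homology.
-/

namespace RipsPersistence

open CategoryTheory AlgebraicTopology

local notation "I" => unitInterval

section Groupoid

variable {B C : Type*} [Category* B] [Groupoid C]

/-- The retraction of a connected groupoid onto its vertex group at `c` determined by a choice of
an arrow from `c` to every object. -/
noncomputable def vertexRetraction {c : C} (e : ∀ d, c ⟶ d) : C ⥤ SingleObj (End c) where
  obj _ := SingleObj.star (End c)
  map {x y} f := (e x ≫ f ≫ inv (e y) : c ⟶ c)
  map_id x := (by simp : e x ≫ 𝟙 x ≫ inv (e x) = 𝟙 c)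
  map_comp {x y z} f g :=
    (by simp : e x ≫ (f ≫ g) ≫ inv (e z) = (e x ≫ f ≫ inv (e y)) ≫ e y ≫ g ≫ inv (e z))

theorem vertexRetraction_map {c : C} (e : ∀ d, c ⟶ d) {x y : C} (f : x ⟶ y) :
    (vertexRetraction e).map f = (e x ≫ f ≫ inv (e y) : c ⟶ c) :=
  rfl

theorem vertexRetraction_map_eq_self {c : C} {e : ∀ d, c ⟶ d} (he : e c = 𝟙 c) (f : c ⟶ c) :
    (vertexRetraction e).map f = f := by
  simp [vertexRetraction_map, he]

/-- The functor to a groupoid with prescribed objects `F b` that is assembled from a functor to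
a vertex group and arrows `e b` from that vertex to all the `F b`. -/
noncomputable def vertexExtension {d : C} {F : B → C} (e : ∀ b, d ⟶ F b)
    (W : B ⥤ SingleObj (End d)) : B ⥤ C where
  obj := F
  map {x y} f := inv (e x) ≫ (W.map f : d ⟶ d) ≫ e y
  map_id x := by
    rw [W.map_id]
    exact (congrArg _ (Category.id_comp _)).trans (IsIso.inv_hom_id _)
  map_comp {x y z} f g := by
    rw [W.map_comp]
    exact (by simp : inv (e x) ≫ ((W.map f : d ⟶ d) ≫ (W.map g : d ⟶ d)) ≫ e z =
      (inv (e x) ≫ (W.map f : d ⟶ d) ≫ e y) ≫ inv (e y) ≫ (W.map g : d ⟶ d) ≫ e z)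

theorem vertexExtension_map_eq {d : C} {F : B → C} (e : ∀ b, d ⟶ F b) (W : B ⥤ SingleObj (End d))
    {x y : B} (f : x ⟶ y) {g : F x ⟶ F y} (h : W.map f = (e x ≫ g ≫ inv (e y) : d ⟶ d)) :
    (vertexExtension e W).map f = g := by
  change inv (e x) ≫ (W.map f : d ⟶ d) ≫ e y = g
  rw [h]
  simp

end Groupoid

section Paths

variable {Y : Type*} [TopologicalSpace Y] {x y z : Y}

/-- The homotopy class of a path, as an arrow of the fundamental groupoid. -/
def pathArrow (p : Path x y) : FundamentalGroupoid.mk x ⟶ FundamentalGroupoid.mk y :=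
  Path.Homotopic.Quotient.mk p

theorem pathArrow_surjective {a b : FundamentalGroupoid Y} (f : a ⟶ b) :
    ∃ p : Path a.as b.as, pathArrow p = f :=
  Path.Homotopic.Quotient.mk_surjective f

theorem pathArrow_eq_of_homotopic {p q : Path x y} (h : p.Homotopic q) :
    pathArrow p = pathArrow q :=
  Path.Homotopic.Quotient.eq.2 h

theorem pathArrow_refl (x : Y) : pathArrow (Path.refl x) = 𝟙 _ :=
  rfl

theorem pathArrow_trans (p : Path x y) (q : Path y z) :
    pathArrow (p.trans q) = pathArrow p ≫ pathArrow q :=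
  rfl

theorem pathArrow_symm (p : Path x y) : pathArrow p.symm = inv (pathArrow p) :=
  Groupoid.inv_eq_inv (pathArrow p)

theorem pathArrow_induction {ι : Type*} {U : ι → Set Y} (hU : ∀ i, IsOpen (U i))
    (hcov : ∀ y, ∃ i, y ∈ U i)
    {P : ∀ ⦃a b : FundamentalGroupoid Y⦄, (a ⟶ b) → Prop}
    (small : ∀ ⦃x y : Y⦄ (p : Path x y) (i : ι), Set.range p ⊆ U i → P (pathArrow p))
    (comp : ∀ ⦃a b c : FundamentalGroupoid Y⦄ (f : a ⟶ b) (g : b ⟶ c), P f → P g → P (f ≫ g))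
    ⦃a b : FundamentalGroupoid Y⦄ (f : a ⟶ b) : P f := by
  obtain ⟨γ, rfl⟩ := pathArrow_surjective f
  obtain ⟨t, ht₀, ht_mono, ⟨n, hn⟩, ht⟩ := exists_monotone_Icc_subset_open_cover_unitInterval
    (c := fun i => γ ⁻¹' U i) (fun i => (hU i).preimage γ.continuous)
    (fun s _ => Set.mem_iUnion.2 (hcov (γ s)))
  have initial : ∀ m, P (pathArrow (γ.subpath 0 (t m))) := by
    intro m
    induction m with
    | zero =>
      obtain ⟨i, hi⟩ := hcov (γ 0)
      refine small _ i ?_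
      rw [ht₀, Path.range_subpath, Set.uIcc_self, Set.image_singleton]
      exact Set.singleton_subset_iff.2 hi
    | succ m ih =>
      obtain ⟨i, hi⟩ := ht m
      have last : P (pathArrow (γ.subpath (t m) (t (m + 1)))) := by
        refine small _ i ?_
        rw [Path.range_subpath_of_le _ _ _ (ht_mono m.le_succ)]
        exact Set.image_subset_iff.2 hi
      rw [← pathArrow_eq_of_homotopic ⟨Path.Homotopy.subpathTransSubpath γ 0 (t m) (t (m + 1))⟩,
        pathArrow_trans]
      exact comp _ _ ih last
  have full := initial n
  rw [hn n le_rfl, Path.subpath_zero_one] at full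
  have cast_iff : ∀ {x' y' : Y} (hx : x' = a.as) (hy : y' = b.as),
      P (pathArrow (γ.cast hx hy)) → P (pathArrow γ) := by
    rintro _ _ rfl rfl h
    exact h
  exact cast_iff _ _ full

theorem naturality_of_locally {D : Type*} [Category* D] {F G : FundamentalGroupoid Y ⥤ D}
    {ι : Type*} {U : ι → Set Y} (hU : ∀ i, IsOpen (U i)) (hcov : ∀ y, ∃ i, y ∈ U i)
    (τ : ∀ a, F.obj a ⟶ G.obj a)
    (small : ∀ ⦃x y : Y⦄ (p : Path x y) (i : ι), Set.range p ⊆ U i →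
      F.map (pathArrow p) ≫ τ ⟨y⟩ = τ ⟨x⟩ ≫ G.map (pathArrow p))
    {a b : FundamentalGroupoid Y} (f : a ⟶ b) : F.map f ≫ τ b = τ a ≫ G.map f := by
  refine pathArrow_induction hU hcov
    (P := fun a b f => F.map f ≫ τ b = τ a ≫ G.map f) small (fun _ _ _ f g hf hg => ?_) f
  rw [F.map_comp, G.map_comp, Category.assoc, hg, reassoc_of% hf]

theorem comp_map_eq_of_locally {D : Type*} [Category* D] {G : FundamentalGroupoid Y ⥤ D}
    {ι : Type*} {U : ι → Set Y} (hU : ∀ i, IsOpen (U i)) (hcov : ∀ y, ∃ i, y ∈ U i)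
    {d : D} (τ : ∀ a, d ⟶ G.obj a)
    (small : ∀ ⦃x y : Y⦄ (p : Path x y) (i : ι), Set.range p ⊆ U i →
      τ ⟨x⟩ ≫ G.map (pathArrow p) = τ ⟨y⟩)
    {a b : FundamentalGroupoid Y} (f : a ⟶ b) : τ a ≫ G.map f = τ b :=
  (naturality_of_locally (F := (Functor.const _).obj d) hU hcov τ
    (fun _ _ p i hp => (Category.id_comp _).trans (small p i hp).symm) f).symm.trans
    (Category.id_comp _)

end Paths

section LocalCocycle

/-- A cocycle with values in a group `Γ` that is defined near the diagonal of `Y`: the cocycle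
identity is only required within the members of the open cover `nhd`. -/
structure LocalCocycle (Y : Type*) [TopologicalSpace Y] (Γ : Type*) [Group Γ] where
  nhd : Y → Set Y
  isOpen_nhd : ∀ i, IsOpen (nhd i)
  mem_nhd : ∀ i, i ∈ nhd i
  /-- The values on pairs that lie in no common `nhd i` are irrelevant. -/
  toFun : Y → Y → Γ
  mul_eq : ∀ i, ∀ x ∈ nhd i, ∀ y ∈ nhd i, ∀ z ∈ nhd i, toFun y z * toFun x y = toFun x z

namespace LocalCocycle

variable {Y : Type*} [TopologicalSpace Y] {Γ : Type*} [Group Γ] (w : LocalCocycle Y Γ)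

theorem self_eq_one (x : Y) : w.toFun x x = 1 :=
  mul_eq_right.1 (w.mul_eq x x (w.mem_nhd x) x (w.mem_nhd x) x (w.mem_nhd x))

theorem inv_eq {i x y : Y} (hx : x ∈ w.nhd i) (hy : y ∈ w.nhd i) :
    (w.toFun x y)⁻¹ = w.toFun y x := by
  rw [inv_eq_iff_mul_eq_one, w.mul_eq i y hy x hx y hy, w.self_eq_one]

/-- The covering space with fibre `Γ` obtained by gluing the pieces `nhd i × Γ` along the
cocycle. -/
def covering [TopologicalSpace Γ] [DiscreteTopology Γ] : FiberBundleCore Y Y Γ where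
  baseSet := w.nhd
  isOpen_baseSet := w.isOpen_nhd
  indexAt := id
  mem_baseSet_at := w.mem_nhd
  coordChange i j y h := w.toFun y j * w.toFun i y * h
  coordChange_self i y hy h := by
    rw [w.mul_eq i i (w.mem_nhd i) y hy i (w.mem_nhd i), w.self_eq_one, one_mul]
  continuousOn_coordChange i j := by
    have locally_const : ∀ y ∈ w.nhd i ∩ w.nhd j, ∀ y' ∈ w.nhd i ∩ w.nhd j,
        w.toFun y' j * w.toFun i y' = w.toFun y j * w.toFun i y := by
      rintro y ⟨hi, hj⟩ y' ⟨hi', hj'⟩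
      rw [← w.mul_eq i i (w.mem_nhd i) y hi y' hi', ← w.mul_eq j y hj y' hj' j (w.mem_nhd j),
        mul_assoc]
    rcases (w.nhd i ∩ w.nhd j).eq_empty_or_nonempty with h | ⟨y, hy⟩
    · simp [h]
    · have cont : Continuous fun h : Γ => w.toFun y j * w.toFun i y * h :=
        continuous_of_discreteTopology
      refine (cont.comp continuous_snd).continuousOn.congr ?_
      rintro ⟨y', h⟩ ⟨hy', -⟩
      simp [locally_const y hy y' hy']
  coordChange_comp i j k y := by
    rintro ⟨⟨-, hj⟩, -⟩ h
    rw [← w.inv_eq (w.mem_nhd j) hj]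
    group

variable [TopologicalSpace Γ] [DiscreteTopology Γ]

/-- The point of the fibre over `y` with coordinate `h`. -/
def fiberPoint (y : Y) (h : Γ) :
    (Bundle.TotalSpace.proj ⁻¹' {y} : Set (Bundle.TotalSpace Γ w.covering.Fiber)) :=
  ⟨⟨y, h⟩, rfl⟩

theorem fiberPoint_injective (y : Y) : Function.Injective (w.fiberPoint y) := by
  intro g h e
  exact eq_of_heq (Bundle.TotalSpace.mk.inj (congrArg Subtype.val e)).2

theorem isCoveringMap_proj :
    IsCoveringMap (Bundle.TotalSpace.proj : Bundle.TotalSpace Γ w.covering.Fiber → Y) :=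
  FiberBundle.isCoveringMap

/-- The lift to the covering space of a path inside some `nhd i`. -/
def liftPath {x y i : Y} (p : Path x y) (hp : Set.range p ⊆ w.nhd i) (h : Γ) :
    Path (w.fiberPoint x h).1 (w.fiberPoint y (w.toFun x y * h)).1 where
  toFun t := (w.fiberPoint (p t) (w.toFun x (p t) * h)).1
  continuous_toFun := by
    have mem : ∀ t, p t ∈ w.nhd i := fun t => hp ⟨t, rfl⟩
    have mem_source : x ∈ w.nhd i := by simpa using mem 0
    have cont : Continuous fun t =>
        (w.covering.localTriv i).toOpenPartialHomeomorph.symm (p t, w.toFun x i * h) :=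
      (w.covering.localTriv i).toOpenPartialHomeomorph.continuousOn_symm.comp_continuous
        (by fun_prop) fun t => (w.covering.mem_localTriv_target i _).2 (mem t)
    refine cont.congr fun t => ?_
    rw [w.covering.localTriv_symm_apply]
    refine congrArg (Bundle.TotalSpace.mk (p t)) ?_
    change w.toFun (p t) (p t) * w.toFun i (p t) * (w.toFun x i * h) = w.toFun x (p t) * h
    rw [w.self_eq_one, one_mul, ← mul_assoc, w.mul_eq i x mem_source i (w.mem_nhd i) _ (mem t)]
  source' := by rw [p.source, w.self_eq_one, one_mul]
  target' := by rw [p.target]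

theorem monodromy_of_range_subset {x y i : Y} (p : Path x y) (hp : Set.range p ⊆ w.nhd i) (h : Γ) :
    w.isCoveringMap_proj.monodromy (pathArrow p) (w.fiberPoint x h) =
      w.fiberPoint y (w.toFun x y * h) :=
  w.isCoveringMap_proj.monodromy_eq_of_map_eq (ex := w.fiberPoint x h)
    (ey := w.fiberPoint y (w.toFun x y * h))
    (Path.Homotopic.Quotient.mk (w.liftPath p hp h)) rfl

theorem exists_monodromy_eq {a b : FundamentalGroupoid Y} (f : a ⟶ b) :
    ∃ g : Γ, ∀ h, w.isCoveringMap_proj.monodromy f (w.fiberPoint a.as h) =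
      w.fiberPoint b.as (g * h) := by
  refine pathArrow_induction w.isOpen_nhd (fun y => ⟨y, w.mem_nhd y⟩)
    (P := fun a b f => ∃ g : Γ, ∀ h, w.isCoveringMap_proj.monodromy f (w.fiberPoint a.as h) =
      w.fiberPoint b.as (g * h))
    (fun x y p i hp => ⟨w.toFun x y, w.monodromy_of_range_subset p hp⟩) ?_ f
  rintro a b c f f' ⟨g, hg⟩ ⟨g', hg'⟩
  refine ⟨g' * g, fun h => ?_⟩
  rw [FundamentalGroupoid.comp_eq, IsCoveringMap.monodromy_trans_apply, hg, hg', mul_assoc]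

omit [TopologicalSpace Γ] [DiscreteTopology Γ] in
theorem exists_functor : ∃ W : FundamentalGroupoid Y ⥤ SingleObj Γ,
    ∀ {x y : Y} (p : Path x y) (i : Y), Set.range p ⊆ w.nhd i →
      W.map (pathArrow p) = w.toFun x y := by
  let _ : TopologicalSpace Γ := ⊥
  have : DiscreteTopology Γ := ⟨rfl⟩
  choose g hg using fun {a b : FundamentalGroupoid Y} (f : a ⟶ b) => w.exists_monodromy_eq f
  have g_eq {a b : FundamentalGroupoid Y} {f : a ⟶ b} {γ : Γ} (h : w.isCoveringMap_proj.monodromy f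
      (w.fiberPoint a.as 1) = w.fiberPoint b.as γ) : g f = γ := by
    rw [hg, mul_one] at h
    exact w.fiberPoint_injective _ h
  refine ⟨
    { obj _ := SingleObj.star Γ
      map f := g f
      map_id a := g_eq ?_
      map_comp f f' := g_eq ?_ },
    fun {x y} p i hp => g_eq ?_⟩
  · exact congrFun w.isCoveringMap_proj.monodromy_refl _
  · rw [FundamentalGroupoid.comp_eq, IsCoveringMap.monodromy_trans_apply, hg, hg, mul_one]
    rfl
  · exact (w.monodromy_of_range_subset p hp 1).trans (by rw [mul_one])

end LocalCocycle

end LocalCocycle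

section Square

variable {Y : Type*} [TopologicalSpace Y]

theorem pathArrow_comp_eq_of_square {a b c d : Y} (H : C(I × I, Y)) {p : Path a b} {q : Path c d}
    {l : Path a c} {r : Path b d} (hp : ∀ s, H (s, 0) = p s) (hq : ∀ s, H (s, 1) = q s)
    (hl : ∀ t, H (0, t) = l t) (hr : ∀ t, H (1, t) = r t) :
    pathArrow p ≫ pathArrow r = pathArrow l ≫ pathArrow q := by
  have : ContractibleSpace I := (convex_Icc 0 1).contractibleSpace ⟨0, by simp⟩
  obtain rfl : H (0, 0) = a := by simpa using hp 0
  obtain rfl : H (1, 0) = b := by simpa using hp 1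
  obtain rfl : H (0, 1) = c := by simpa using hq 0
  obtain rfl : H (1, 1) = d := by simpa using hq 1
  obtain rfl : (Path.id.prod (Path.refl 0)).map H.continuous = p := Path.ext (funext hp)
  obtain rfl : (Path.id.prod (Path.refl 1)).map H.continuous = q := Path.ext (funext hq)
  obtain rfl : ((Path.refl 0).prod Path.id).map H.continuous = l := Path.ext (funext hl)
  obtain rfl : ((Path.refl 1).prod Path.id).map H.continuous = r := Path.ext (funext hr)
  have boundary : pathArrow (Path.id.prod (Path.refl (0 : I))) ≫
        pathArrow ((Path.refl (1 : I)).prod Path.id) =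
      pathArrow ((Path.refl (0 : I)).prod Path.id) ≫
        pathArrow (Path.id.prod (Path.refl (1 : I))) :=
    Subsingleton.elim (α := Path.Homotopic.Quotient (0, 0) (1, 1)) _ _
  have := congrArg (FundamentalGroupoid.map H).map boundary
  rwa [Functor.map_comp, Functor.map_comp] at this

end Square

variable {V : Type u} {K : AbstractSimplicialComplex V}

/-- The set `S` of vertices lies in a simplex of `K`. -/
def SpansFace (K : AbstractSimplicialComplex V) (S : Set V) : Prop :=
  ∃ σ ∈ K.faces, S ⊆ ↑σ

theorem SpansFace.mono {S T : Set V} (h : SpansFace K T) (hST : S ⊆ T) : SpansFace K S :=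
  let ⟨σ, hσ, hT⟩ := h
  ⟨σ, hσ, hST.trans hT⟩

namespace Realization

/-- The vertices with nonzero barycentric coordinate: the simplex whose interior contains `x`. -/
def support (x : Realization K) : Set V :=
  {v | x.coord v ≠ 0}

theorem mem_support {x : Realization K} {v : V} : v ∈ x.support ↔ x.coord v ≠ 0 :=
  Iff.rfl

theorem coord_pos {x : Realization K} {v : V} (h : v ∈ x.support) : 0 < x.coord v :=
  (x.nonneg v).lt_of_ne' h

theorem coord_eq_zero_of_notMem {x : Realization K} {S : Set V} (h : x.support ⊆ S) {v : V}
    (hv : v ∉ S) : x.coord v = 0 :=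
  not_not.1 fun hne => hv (h hne)

theorem spansFace_support (x : Realization K) : SpansFace K x.support := by
  obtain ⟨σ, hσ, h, -⟩ := x.exists_face
  exact ⟨σ, hσ, fun v hv => by_contra fun hvσ => hv (h v hvσ)⟩

theorem support_nonempty (x : Realization K) : x.support.Nonempty := by
  by_contra! h
  obtain ⟨σ, -, -, hsum⟩ := x.exists_face
  refine zero_ne_one (α := ℝ) ?_
  rw [← hsum, Finset.sum_eq_zero fun v _ => coord_eq_zero_of_notMem h.subset (Set.notMem_empty v)]

theorem sum_coord_of_support_subset {x : Realization K} {σ : Finset V} (h : x.support ⊆ σ) :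
    ∑ v ∈ σ, x.coord v = 1 := by
  classical
  obtain ⟨τ, -, hτ, hsum⟩ := x.exists_face
  rw [← hsum, Finset.sum_subset Finset.subset_union_left fun v _ hv =>
      coord_eq_zero_of_notMem h hv,
    Finset.sum_subset (Finset.subset_union_right (s₁ := σ)) fun v _ hv => hτ v hv]

theorem support_vertex (v : V) : (vertex K v).support = {v} := by
  ext w
  simp [mem_support, vertex]

theorem support_face_subset (σ : K.faces) (s : stdSimplex ℝ (σ.1 : Finset V)) :
    (face K σ s).support ⊆ σ.1 := by
  intro v hv
  by_contra h
  exact hv (dif_neg h)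

theorem exists_face_eq {x : Realization K} {σ : K.faces} (h : x.support ⊆ σ.1) :
    ∃ s, face K σ s = x := by
  refine ⟨⟨fun v => x.coord v, fun v => x.nonneg v, ?_⟩, ?_⟩
  · rw [Finset.sum_coe_sort σ.1 fun v => x.coord v, sum_coord_of_support_subset h]
  · ext v
    by_cases hv : v ∈ σ.1
    · simp [face, hv]
    · simp [face, hv, coord_eq_zero_of_notMem h hv]

theorem continuous_coord (v : V) : Continuous fun x : Realization K => x.coord v := by
  rw [continuous_iff]
  intro σ
  by_cases hv : v ∈ σ.1
  · simpa [Function.comp_def, face, hv] using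
      (continuous_apply _).comp continuous_subtype_val
  · simpa [Function.comp_def, face, hv] using continuous_const

theorem continuous_of_support_subset {T : Type*} [TopologicalSpace T] {f : T → Realization K}
    {σ : K.faces} (hσ : ∀ t, (f t).support ⊆ σ.1) (hf : ∀ v, Continuous fun t => (f t).coord v) :
    Continuous f := by
  choose s hs using fun t => exists_face_eq (hσ t)
  suffices Continuous s from ((continuous_face K σ).comp this).congr hs
  refine Continuous.subtype_mk (continuous_pi fun v => ?_) fun t => (s t).2
  refine (hf v).congr fun t => ?_
  rw [← hs]
  exact dif_pos v.2

theorem continuous_prod_of_face {Z T : Type*} [TopologicalSpace Z] [TopologicalSpace T]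
    [LocallyCompactSpace T] {F : Realization K × T → Z}
    (h : ∀ σ : K.faces, Continuous fun q : stdSimplex ℝ (σ.1 : Finset V) × T =>
      F (face K σ q.1, q.2)) : Continuous F := by
  have continuous_right : ∀ x, Continuous fun t => F (x, t) := by
    intro x
    obtain ⟨σ, hσ, hx⟩ := x.spansFace_support
    obtain ⟨s, rfl⟩ := exists_face_eq (σ := ⟨σ, hσ⟩) hx
    exact (h ⟨σ, hσ⟩).comp (Continuous.prodMk_right s)
  let curried : C(Realization K, C(T, Z)) :=
    { toFun x := ⟨fun t => F (x, t), continuous_right x⟩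
      continuous_toFun := (continuous_iff _).2 fun σ =>
        (ContinuousMap.curry ⟨_, h σ⟩).continuous }
  exact ContinuousMap.continuous_uncurry_of_continuous curried

/-- The point `(1 - a) x + a y` of a simplex that contains both `x` and `y`. The case `a = 0`, in
which no such simplex is needed, is included because the deformation of the star of a vertex has to
be cut off outside of the star. -/
noncomputable def mix (x y : Realization K) (a : I)
    (h : a = 0 ∨ SpansFace K (x.support ∪ y.support)) : Realization K where
  coord v := (1 - a) * x.coord v + a * y.coord v
  nonneg v := add_nonneg (mul_nonneg (sub_nonneg.2 a.2.2) (x.nonneg v))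
    (mul_nonneg a.2.1 (y.nonneg v))
  exists_face := by
    rcases h with rfl | ⟨σ, hσ, h⟩
    · simpa using x.exists_face
    · obtain ⟨hx, hy⟩ := Set.union_subset_iff.1 h
      refine ⟨σ, hσ, fun v hv => ?_, ?_⟩
      · simp [coord_eq_zero_of_notMem hx hv, coord_eq_zero_of_notMem hy hv]
      · rw [Finset.sum_add_distrib, ← Finset.mul_sum, ← Finset.mul_sum,
          sum_coord_of_support_subset hx, sum_coord_of_support_subset hy]
        ring

section Mix

variable {x y : Realization K} {a : I}

theorem mix_coord (h : a = 0 ∨ SpansFace K (x.support ∪ y.support)) (v : V) :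
    (mix x y a h).coord v = (1 - a) * x.coord v + a * y.coord v :=
  rfl

theorem mix_zero (h : (0 : I) = 0 ∨ SpansFace K (x.support ∪ y.support)) : mix x y 0 h = x := by
  ext v
  simp [mix_coord]

theorem mix_one (h : (1 : I) = 0 ∨ SpansFace K (x.support ∪ y.support)) : mix x y 1 h = y := by
  ext v
  simp [mix_coord]

theorem mix_self (h : a = 0 ∨ SpansFace K (x.support ∪ x.support)) : mix x x a h = x := by
  ext v
  rw [mix_coord]
  ring

theorem support_mix_subset (h : a = 0 ∨ SpansFace K (x.support ∪ y.support)) {S : Set V}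
    (hx : x.support ⊆ S) (hy : a = 0 ∨ y.support ⊆ S) : (mix x y a h).support ⊆ S := by
  rcases hy with rfl | hy
  · rwa [mix_zero]
  · intro v hv
    by_contra hvS
    refine hv ?_
    rw [mix_coord, coord_eq_zero_of_notMem hx hvS, coord_eq_zero_of_notMem hy hvS]
    simp

theorem inter_support_subset_support_mix (h : a = 0 ∨ SpansFace K (x.support ∪ y.support)) :
    x.support ∩ y.support ⊆ (mix x y a h).support := by
  rintro v ⟨hx, hy⟩
  have hx := coord_pos hx
  have hy := coord_pos hy
  rw [mem_support, mix_coord]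
  nlinarith [a.2.1, a.2.2, mul_nonneg a.2.1 hy.le, mul_nonneg (sub_nonneg.2 a.2.2) hx.le]

theorem continuous_mix {T : Type*} [TopologicalSpace T] {f g : T → Realization K} {a : T → I}
    (h : ∀ t, a t = 0 ∨ SpansFace K ((f t).support ∪ (g t).support)) {σ : K.faces}
    (hf : ∀ t, (f t).support ⊆ σ.1) (hg : ∀ t, a t = 0 ∨ (g t).support ⊆ σ.1)
    (hf_cont : Continuous f) (hg_cont : Continuous g) (ha_cont : Continuous a) :
    Continuous fun t => mix (f t) (g t) (a t) (h t) := by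
  refine continuous_of_support_subset (fun t => support_mix_subset (h t) (hf t) (hg t)) fun v => ?_
  have hf_coord := (continuous_coord v).comp hf_cont
  have hg_coord := (continuous_coord v).comp hg_cont
  simp only [Function.comp_def] at hf_coord hg_coord
  simp only [mix_coord]
  fun_prop

end Mix

theorem pathArrow_eq_of_support_subset {x y : Realization K} {p q : Path x y} {σ : K.faces}
    (hp : ∀ t, (p t).support ⊆ σ.1) (hq : ∀ t, (q t).support ⊆ σ.1) :
    pathArrow p = pathArrow q := by
  have spans : ∀ t, SpansFace K ((p t).support ∪ (q t).support) := fun t =>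
    ⟨σ, σ.2, Set.union_subset (hp t) (hq t)⟩
  refine pathArrow_eq_of_homotopic ⟨{
    toFun z := mix (p z.2) (q z.2) z.1 (.inr (spans z.2))
    continuous_toFun := continuous_mix _ (fun z => hp z.2) (fun z => .inr (hq z.2))
      (by fun_prop) (by fun_prop) continuous_fst
    map_zero_left t := mix_zero _
    map_one_left t := mix_one _
    prop' s t ht := ?_ }⟩
  rcases ht with rfl | rfl
  · change mix (p 0) (q 0) s (.inr (spans 0)) = p 0
    simp only [p.source, q.source, mix_self]
  · change mix (p 1) (q 1) s (.inr (spans 1)) = p 1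
    simp only [p.target, q.target, mix_self]

/-- The straight path between two points of a simplex. -/
noncomputable def line (x y : Realization K) (h : SpansFace K (x.support ∪ y.support)) :
    Path x y where
  toFun t := mix x y t (.inr h)
  continuous_toFun := by
    obtain ⟨σ, hσ, h'⟩ := h
    obtain ⟨hx, hy⟩ := Set.union_subset_iff.1 h'
    exact continuous_mix (σ := ⟨σ, hσ⟩) _ (fun _ => hx) (fun _ => .inr hy) continuous_const
      continuous_const continuous_id
  source' := mix_zero _
  target' := mix_one _

theorem line_apply (x y : Realization K) (h : SpansFace K (x.support ∪ y.support)) (t : I) :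
    line x y h t = mix x y t (.inr h) :=
  rfl

theorem pathArrow_line_comp {x y z : Realization K} (hxy : SpansFace K (x.support ∪ y.support))
    (hyz : SpansFace K (y.support ∪ z.support)) (hxz : SpansFace K (x.support ∪ z.support))
    (h : SpansFace K (x.support ∪ y.support ∪ z.support)) :
    pathArrow (line x y hxy) ≫ pathArrow (line y z hyz) = pathArrow (line x z hxz) := by
  obtain ⟨σ, hσ, h'⟩ := h
  obtain ⟨⟨hx, hy⟩, hz⟩ := by simpa only [Set.union_subset_iff] using h'
  refine pathArrow_eq_of_support_subset (σ := ⟨σ, hσ⟩) (p := (line x y hxy).trans (line y z hyz))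
    (fun t => ?_) fun t => support_mix_subset (.inr hxz) hx (.inr hz)
  rw [Path.trans_apply]
  split_ifs
  · exact support_mix_subset (.inr hxy) hx (.inr hy)
  · exact support_mix_subset (.inr hyz) hy (.inr hz)

/-- The open star of a vertex. -/
def openStar (K : AbstractSimplicialComplex V) (v : V) : Set (Realization K) :=
  {x | v ∈ x.support}

theorem isOpen_openStar (v : V) : IsOpen (openStar K v) :=
  isOpen_ne.preimage (continuous_coord v)

theorem range_line_subset_openStar {x y : Realization K} {v : V} (hx : v ∈ x.support)
    (hy : v ∈ y.support) (h : SpansFace K (x.support ∪ y.support)) :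
    Set.range (line x y h) ⊆ openStar K v := by
  rintro _ ⟨t, rfl⟩
  exact inter_support_subset_support_mix (.inr h) ⟨hx, hy⟩

theorem spansFace_support_union_vertex {x : Realization K} {v : V} (hv : v ∈ x.support) :
    SpansFace K (x.support ∪ (vertex K v).support) :=
  x.spansFace_support.mono <| by
    rw [support_vertex, Set.union_singleton, Set.insert_eq_of_mem hv]

/-- The class of the straight path from a point to a vertex of its support. -/
noncomputable def toVertex (x : Realization K) (v : V) (hv : v ∈ x.support) :
    FundamentalGroupoid.mk x ⟶ FundamentalGroupoid.mk (vertex K v) :=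
  pathArrow (line x (vertex K v) (spansFace_support_union_vertex hv))

theorem exists_cutoff {x y : Realization K} (p : Path x y) {v : V}
    (hp : Set.range p ⊆ openStar K v) :
    ∃ c : C(Realization K, I), (∀ z, v ∉ z.support → c z = 0) ∧ ∀ t, c (p t) = 1 := by
  obtain ⟨t₀, -, ht₀⟩ := isCompact_univ.exists_isMinOn (Set.univ_nonempty (α := I))
    ((continuous_coord (K := K) v).comp p.continuous).continuousOn
  have min_pos : 0 < (p t₀).coord v := coord_pos (hp ⟨t₀, rfl⟩)
  refine ⟨⟨fun z => Set.projIcc 0 1 zero_le_one (z.coord v / (p t₀).coord v), ?_⟩,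
    fun z hz => ?_, fun t => ?_⟩
  · exact continuous_projIcc.comp ((continuous_coord v).div_const _)
  · refine Set.projIcc_of_le_left zero_le_one ?_
    rw [coord_eq_zero_of_notMem subset_rfl hz, zero_div]
  · exact Set.projIcc_of_right_le zero_le_one ((one_le_div min_pos).2 (ht₀ (Set.mem_univ t)))

theorem pathArrow_of_range_subset_openStar {x y : Realization K} (p : Path x y) {v : V}
    (hp : Set.range p ⊆ openStar K v) (hx : v ∈ x.support) (hy : v ∈ y.support) :
    pathArrow p = toVertex x v hx ≫ inv (toVertex y v hy) := by
  obtain ⟨c, hc_zero, hc_one⟩ := exists_cutoff p hp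
  have allowed : ∀ (z : Realization K) (s : I),
      s * c z = 0 ∨ SpansFace K (z.support ∪ (vertex K v).support) := fun z s =>
    (em (v ∈ z.support)).symm.imp (fun hz => by rw [hc_zero z hz, mul_zero])
      spansFace_support_union_vertex
  let F : Realization K × I → Realization K := fun q =>
    mix q.1 (vertex K v) (q.2 * c q.1) (allowed q.1 q.2)
  have F_cont : Continuous F := by
    refine continuous_prod_of_face fun σ => continuous_mix (σ := σ) _
      (fun q => support_face_subset σ q.1) (fun q => ?_)
      ((continuous_face K σ).comp continuous_fst) continuous_const
      (continuous_snd.mul (c.continuous.comp ((continuous_face K σ).comp continuous_fst)))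
    rw [support_vertex, Set.singleton_subset_iff]
    by_cases hv : v ∈ σ.1
    · exact .inr hv
    · exact .inl (by rw [hc_zero _ fun h => hv (support_face_subset σ q.1 h), mul_zero])
  have square := pathArrow_comp_eq_of_square ⟨fun q : I × I => F (p q.1, q.2), by fun_prop⟩
    (p := p) (q := Path.refl (vertex K v))
    (l := line x _ (spansFace_support_union_vertex hx))
    (r := line y _ (spansFace_support_union_vertex hy))
    (fun t => by simp [F, mix_zero]) (fun t => by simp [F, hc_one, mix_one])
    (fun s => by
      have c_one : c x = 1 := by simpa using hc_one 0
      simp [F, c_one, line_apply])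
    (fun s => by
      have c_one : c y = 1 := by simpa using hc_one 1
      simp [F, c_one, line_apply])
  rw [pathArrow_refl, Category.comp_id] at square
  exact (IsIso.eq_comp_inv _).2 square

/-- The class of the edge path between two vertices of a simplex. -/
noncomputable def edge (v w : V) (h : SpansFace K {v, w}) :
    FundamentalGroupoid.mk (vertex K v) ⟶ FundamentalGroupoid.mk (vertex K w) :=
  pathArrow (line _ _ (by rwa [support_vertex, support_vertex]))

theorem toVertex_comp_edge {x : Realization K} {v w : V} (hv : v ∈ x.support)
    (hw : w ∈ x.support) (h : SpansFace K {v, w}) :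
    toVertex x v hv ≫ edge v w h = toVertex x w hw := by
  refine pathArrow_line_comp _ _ _ (x.spansFace_support.mono ?_)
  simp only [support_vertex, Set.union_subset_iff, Set.singleton_subset_iff, hv, hw, and_self,
    subset_rfl]

theorem edge_comp {u v w : V} (huv : SpansFace K {u, v}) (hvw : SpansFace K {v, w})
    (huw : SpansFace K {u, w}) (h : SpansFace K {u, v, w}) :
    edge u v huv ≫ edge v w hvw = edge u w huw := by
  refine pathArrow_line_comp _ _ _ ?_
  rwa [support_vertex, support_vertex, support_vertex, Set.union_assoc]

theorem edge_self (v : V) (h : SpansFace K {v, v}) : edge v v h = 𝟙 _ := by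
  rw [← cancel_epi (edge v v h), edge_comp h h h (by simpa using h), Category.comp_id]

theorem exists_edge_eq_toVertex {v w : V} (h : SpansFace K {v, w}) :
    ∃ (x : Realization K) (hv : v ∈ x.support) (hw : w ∈ x.support),
      edge v w h = inv (toVertex x v hv) ≫ toVertex x w hw := by
  have h' : SpansFace K ((vertex K v).support ∪ (vertex K w).support) := by
    rwa [support_vertex, support_vertex]
  have half : (⟨1 / 2, by norm_num, by norm_num⟩ : I) = 0 ∨
      SpansFace K ((vertex K v).support ∪ (vertex K w).support) := .inr h'
  have mem : ∀ u ∈ ({v, w} : Set V), u ∈ (mix _ _ _ half).support := by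
    rintro u (rfl | rfl) <;> rw [mem_support, mix_coord] <;> simp only [vertex] <;> split_ifs <;>
      norm_num
  exact ⟨mix _ _ _ half, mem v (by simp), mem w (by simp),
    (IsIso.eq_inv_comp _).2 (toVertex_comp_edge _ _ h)⟩

/-- A vertex of the support of `x`, chosen once and for all. -/
noncomputable def someVertex (x : Realization K) : V :=
  x.support_nonempty.some

theorem someVertex_mem (x : Realization K) : x.someVertex ∈ x.support :=
  x.support_nonempty.some_mem

theorem someVertex_vertex (v : V) : (vertex K v).someVertex = v := by
  simpa [support_vertex] using someVertex_mem (vertex K v)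

section Cocycle

variable {Γ : Type*} [Group Γ] {g : V → V → Γ}

theorem cocycle_self (hg : ∀ x y z, SpansFace K {x, y, z} → g y z * g x y = g x z) (v : V) :
    g v v = 1 :=
  mul_eq_right.1 (hg v v v ⟨{v}, K.singleton_mem v, by simp⟩)

theorem exists_localCocycle (hg : ∀ x y z, SpansFace K {x, y, z} → g y z * g x y = g x z) :
    ∃ c : LocalCocycle (Realization K) Γ, (∀ x, c.nhd x = openStar K x.someVertex) ∧
      ∀ x y v, v ∈ x.support → v ∈ y.support →
        c.toFun x y = g v y.someVertex * g x.someVertex v := by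
  classical
  have cocycle (u : Realization K) {x y z : V} (hx : x ∈ u.support) (hy : y ∈ u.support)
      (hz : z ∈ u.support) : g y z * g x y = g x z :=
    hg x y z (u.spansFace_support.mono (by
      simp only [Set.insert_subset_iff, Set.singleton_subset_iff, hx, hy, hz, and_self]))
  let w (x y : Realization K) : Γ :=
    if h : ∃ v, v ∈ x.support ∩ y.support then g h.choose y.someVertex * g x.someVertex h.choose
    else 1
  have w_eq (x y : Realization K) (v : V) (hx : v ∈ x.support) (hy : v ∈ y.support) :
      w x y = g v y.someVertex * g x.someVertex v := by
    have h : ∃ v, v ∈ x.support ∩ y.support := ⟨v, hx, hy⟩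
    obtain ⟨hx', hy'⟩ := h.choose_spec
    simp only [w, dif_pos h]
    rw [← cocycle y hy' hy y.someVertex_mem, ← cocycle x x.someVertex_mem hx' hx, mul_assoc]
  refine ⟨⟨fun x => openStar K x.someVertex, fun x => isOpen_openStar _, someVertex_mem, w, ?_⟩,
    fun _ => rfl, w_eq⟩
  intro i x hx y hy z hz
  rw [w_eq x y _ hx hy, w_eq y z _ hy hz, w_eq x z _ hx hz, mul_assoc,
    ← mul_assoc (g _ i.someVertex), cocycle y hy y.someVertex_mem hy, cocycle_self hg, one_mul]

theorem exists_functor_of_cocycle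
    (hg : ∀ x y z, SpansFace K {x, y, z} → g y z * g x y = g x z) :
    ∃ W : FundamentalGroupoid (Realization K) ⥤ SingleObj Γ,
      ∀ v w (h : SpansFace K {v, w}), W.map (edge v w h) = g v w := by
  obtain ⟨c, c_nhd, c_eq⟩ := exists_localCocycle hg
  obtain ⟨W, hW⟩ := c.exists_functor
  have W_toVertex (u : Realization K) (v : V) (hv : v ∈ u.support) :
      W.map (toVertex u v hv) = g u.someVertex v := by
    have hv' : v ∈ (vertex K v).support := by simp [support_vertex]
    refine (hW _ (vertex K v) ?_).trans ?_
    · rw [c_nhd, someVertex_vertex]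
      exact range_line_subset_openStar hv hv' _
    · rw [c_eq u (vertex K v) v hv hv', someVertex_vertex, cocycle_self hg, one_mul]
  refine ⟨W, fun v w h => ?_⟩
  obtain ⟨x, hv, hw, edge_eq⟩ := exists_edge_eq_toVertex h
  rw [edge_eq, Functor.map_comp, Functor.map_inv, SingleObj.inv_as_inv, W_toVertex, W_toVertex,
    SingleObj.comp_as_mul, mul_inv_eq_iff_eq_mul]
  refine (hg _ _ _ (x.spansFace_support.mono ?_)).symm
  simp only [Set.insert_subset_iff, Set.singleton_subset_iff, x.someVertex_mem, hv, hw, and_self]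

end Cocycle

end Realization

section Geodesics

variable {X : Type u} [MetricSpace X]

namespace IsGeodesicSpace

theorem exists_path (hX : IsGeodesicSpace X) (x y : X) :
    ∃ γ : Path x y, ∀ s t, dist (γ s) (γ t) = |(s : ℝ) - t| * dist x y := by
  obtain ⟨γ, h0, h1, h⟩ := hX x y
  have scaled_mem : ∀ t : I, (t : ℝ) * dist x y ∈ Set.Icc 0 (dist x y) := fun t =>
    ⟨mul_nonneg t.2.1 dist_nonneg, mul_le_of_le_one_left dist_nonneg t.2.2⟩
  have dist_scaled : ∀ s t : I, dist (γ (s * dist x y)) (γ (t * dist x y)) =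
      |(s : ℝ) - t| * dist x y := fun s t => by
    rw [h _ (scaled_mem s) _ (scaled_mem t), ← sub_mul, abs_mul, abs_of_nonneg dist_nonneg]
  refine ⟨⟨⟨fun t => γ (t * dist x y), ?_⟩, by simpa using h0, by simpa using h1⟩, dist_scaled⟩
  refine LipschitzWith.continuous (K := ⟨dist x y, dist_nonneg⟩)
    (LipschitzWith.of_dist_le_mul fun s t => ?_)
  rw [dist_scaled, mul_comm]
  rfl

theorem pathConnectedSpace [Nonempty X] (hX : IsGeodesicSpace X) : PathConnectedSpace X :=
  ⟨inferInstance, fun x y => ⟨(hX.exists_path x y).choose⟩⟩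

/-- A path from `x` to `y` that has constant speed and length `dist x y`. -/
noncomputable def geodesic (hX : IsGeodesicSpace X) (x y : X) : Path x y :=
  (hX.exists_path x y).choose

variable (hX : IsGeodesicSpace X)
include hX

theorem dist_geodesic (x y : X) (s t : I) :
    dist (hX.geodesic x y s) (hX.geodesic x y t) = |(s : ℝ) - t| * dist x y :=
  (hX.exists_path x y).choose_spec s t

theorem dist_left_geodesic (x y : X) (t : I) : dist x (hX.geodesic x y t) = t * dist x y := by
  simpa [abs_of_nonneg t.2.1] using hX.dist_geodesic x y 0 t

theorem dist_geodesic_right (x y : X) (t : I) :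
    dist (hX.geodesic x y t) y = (1 - t) * dist x y := by
  simpa [abs_of_nonpos (sub_nonpos.2 t.2.2)] using hX.dist_geodesic x y t 1

theorem dist_add_dist_of_mem_range {x y z : X} (hz : z ∈ Set.range (hX.geodesic x y)) :
    dist x z + dist z y = dist x y := by
  obtain ⟨t, rfl⟩ := hz
  rw [dist_left_geodesic, dist_geodesic_right]
  ring

theorem exists_range_geodesic_subset_ball {x y : X} {r : ℝ} (h : dist x y < r) :
    ∃ m, Set.range (hX.geodesic x y) ⊆ Metric.ball m (r / 2) := by
  refine ⟨hX.geodesic x y ⟨1 / 2, by norm_num, by norm_num⟩, ?_⟩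
  rintro _ ⟨t, rfl⟩
  rw [Metric.mem_ball, dist_geodesic]
  have close_to_half : |(t : ℝ) - 1 / 2| ≤ 1 / 2 :=
    abs_le.2 ⟨by linarith [t.2.1], by linarith [t.2.2]⟩
  linarith [mul_le_mul_of_nonneg_right close_to_half (dist_nonneg (x := x) (y := y))]

theorem exists_dist_eq (x y : X) {a : ℝ} (h0 : 0 ≤ a) (h1 : a ≤ dist x y) :
    ∃ m, dist x m = a ∧ dist m y = dist x y - a := by
  obtain ⟨γ, hx, hy, h⟩ := hX x y
  refine ⟨γ a, ?_, ?_⟩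
  · simpa [hx, abs_of_nonneg h0] using h 0 ⟨le_rfl, dist_nonneg⟩ a ⟨h0, h1⟩
  · simpa [hy, abs_of_nonpos (sub_nonpos.2 h1)] using
      h a ⟨h0, h1⟩ (dist x y) ⟨dist_nonneg, le_rfl⟩

theorem diam_triangle_le (x y z : X) :
    Metric.diam (Set.range ((hX.geodesic x y).trans (hX.geodesic y z)) ∪
      Set.range (hX.geodesic x z)) ≤ (dist x y + dist y z + dist x z) / 2 := by
  refine Metric.diam_le_of_forall_dist_le (by positivity) ?_
  rw [Path.trans_range]
  intro P hP Q hQ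
  have := dist_triangle_right x y z
  have := dist_triangle_left y z x
  have := dist_triangle x y z
  have (R : X) : dist P Q ≤ dist P R + dist R Q := dist_triangle _ _ _
  have (R S : X) : dist P Q ≤ dist P R + dist R S + dist S Q := dist_triangle4 _ _ _ _
  rcases hP with (hP | hP) | hP <;> rcases hQ with (hQ | hQ) | hQ <;>
    · have := hX.dist_add_dist_of_mem_range hP
      have := hX.dist_add_dist_of_mem_range hQ
      grind [dist_comm]

end IsGeodesicSpace

end Geodesics

section Rips

open Realization

variable {X : Type u} [MetricSpace X] {r : Set.Ioi (0 : ℝ)} {x y z : X}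

theorem dist_lt_of_spansFace {S : Set X} (h : SpansFace (rips X r) S) (hx : x ∈ S) (hy : y ∈ S) :
    dist x y < r.1 := by
  obtain ⟨σ, hσ, hS⟩ := h
  exact (Metric.dist_le_diam_of_mem σ.finite_toSet.isBounded (hS hx) (hS hy)).trans_lt hσ.2

theorem spansFace_rips {S : Finset X} (hS : S.Nonempty) (h : ∀ x ∈ S, ∀ y ∈ S, dist x y < r.1) :
    SpansFace (rips X r) (S : Set X) := by
  obtain ⟨⟨a, b⟩, hab, hmax⟩ := (S ×ˢ S).exists_max_image (fun q => dist q.1 q.2) (hS.product hS)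
  rw [Finset.mem_product] at hab
  refine ⟨S, ⟨hS, lt_of_le_of_lt (Metric.diam_le_of_forall_dist_le dist_nonneg
    fun x hx y hy => ?_) (h a hab.1 b hab.2)⟩, subset_rfl⟩
  exact hmax (x, y) (Finset.mem_product.2 ⟨hx, hy⟩)

theorem spansFace_rips_triple (hxy : dist x y < r.1) (hyz : dist y z < r.1)
    (hxz : dist x z < r.1) : SpansFace (rips X r) {x, y, z} := by
  classical
  have r_pos : 0 < r.1 := r.2
  simpa using spansFace_rips (r := r) (S := {x, y, z}) (by simp) (by
    simp [hxy, hyz, hxz, dist_comm y x, dist_comm z x, dist_comm z y, r_pos])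

theorem spansFace_rips_pair (h : dist x y < r.1) : SpansFace (rips X r) {x, y} := by
  simpa using spansFace_rips_triple ((dist_self x).trans_lt r.2) h h

/-- The class of the edge path between two points of `X` at distance less than `r`. -/
noncomputable def ripsEdge (h : dist x y < r.1) :
    FundamentalGroupoid.mk (vertex (rips X r) x) ⟶ FundamentalGroupoid.mk (vertex (rips X r) y) :=
  edge x y (spansFace_rips_pair h)

theorem ripsEdge_comp (hxy : dist x y < r.1) (hyz : dist y z < r.1) (hxz : dist x z < r.1) :
    ripsEdge hxy ≫ ripsEdge hyz = ripsEdge hxz :=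
  edge_comp _ _ _ (spansFace_rips_triple hxy hyz hxz)

theorem dist_lt_of_mem_ball {m : X} {s : ℝ} (hx : x ∈ Metric.ball m (s / 2))
    (hy : y ∈ Metric.ball m (s / 2)) : dist x y < s := by
  have := dist_triangle_right x y m
  rw [Metric.mem_ball] at hx hy
  linarith

theorem exists_mem_ball_half (r : Set.Ioi (0 : ℝ)) (x : X) :
    ∃ m, x ∈ Metric.ball m (r.1 / 2) :=
  ⟨x, Metric.mem_ball_self (half_pos r.2)⟩

variable [PathConnectedSpace X]

variable (r) in
theorem nonempty_rips_arrow (x y : X) :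
    Nonempty (FundamentalGroupoid.mk (vertex (rips X r) x) ⟶
      FundamentalGroupoid.mk (vertex (rips X r) y)) := by
  refine pathArrow_induction (fun m : X => Metric.isOpen_ball) (exists_mem_ball_half r)
    (P := fun a b _ => Nonempty (FundamentalGroupoid.mk (vertex (rips X r) a.as) ⟶
      FundamentalGroupoid.mk (vertex (rips X r) b.as))) (fun x y p m hp => ?_)
    (fun a b c _ _ ⟨f⟩ ⟨g⟩ => ⟨f ≫ g⟩) (pathArrow (PathConnectedSpace.somePath x y))
  exact ⟨ripsEdge (dist_lt_of_mem_ball (hp p.source_mem_range) (hp p.target_mem_range))⟩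

/-- An arrow between two vertices of the Rips complex, chosen once and for all. -/
noncomputable def ripsArrow (r : Set.Ioi (0 : ℝ)) (x y : X) :
    FundamentalGroupoid.mk (vertex (rips X r) x) ⟶ FundamentalGroupoid.mk (vertex (rips X r) y) :=
  (nonempty_rips_arrow r x y).some

theorem exists_ripsMonodromy (r : Set.Ioi (0 : ℝ)) (x₀ : X) :
    ∃ W : FundamentalGroupoid X ⥤
        SingleObj (End (FundamentalGroupoid.mk (vertex (rips X r) x₀))),
      ∀ {x y : X} (p : Path x y) (m : X), Set.range p ⊆ Metric.ball m (r.1 / 2) →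
        ∀ h : dist x y < r.1, W.map (pathArrow p) =
          (ripsArrow r x₀ x ≫ ripsEdge h ≫ inv (ripsArrow r x₀ y) :) := by
  classical
  let w : LocalCocycle X (End (FundamentalGroupoid.mk (vertex (rips X r) x₀))) :=
    { nhd m := Metric.ball m (r.1 / 2)
      isOpen_nhd m := Metric.isOpen_ball
      mem_nhd m := Metric.mem_ball_self (half_pos r.2)
      toFun x y := if h : dist x y < r.1 then
        (ripsArrow r x₀ x ≫ ripsEdge h ≫ inv (ripsArrow r x₀ y) :) else 1
      mul_eq m x hx y hy z hz := by
        have hxy := dist_lt_of_mem_ball hx hy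
        have hyz := dist_lt_of_mem_ball hy hz
        have hxz := dist_lt_of_mem_ball hx hz
        rw [dif_pos hxy, dif_pos hyz, dif_pos hxz, ← ripsEdge_comp hxy hyz hxz, End.mul_def]
        simp }
  obtain ⟨W, hW⟩ := w.exists_functor
  exact ⟨W, fun p m hp h => (hW p m hp).trans (dif_pos h)⟩

/-- The functor that sends a point of `X` to the corresponding vertex of the Rips complex and a
path of small diameter to the edge between its end points. -/
noncomputable def ripsFunctor (r : Set.Ioi (0 : ℝ)) :
    FundamentalGroupoid X ⥤ FundamentalGroupoid (Realization (rips X r)) :=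
  vertexExtension (F := fun a => FundamentalGroupoid.mk (vertex (rips X r) a.as))
    (fun a => ripsArrow r (Classical.arbitrary X) a.as)
    (exists_ripsMonodromy r (Classical.arbitrary X)).choose

theorem ripsFunctor_map_of_range_subset_ball (p : Path x y) {m : X}
    (hp : Set.range p ⊆ Metric.ball m (r.1 / 2)) (h : dist x y < r.1) :
    (ripsFunctor r).map (pathArrow p) = ripsEdge h :=
  vertexExtension_map_eq _ _ _
    ((exists_ripsMonodromy r (Classical.arbitrary X)).choose_spec p m hp h)

theorem ripsFunctor_map_geodesic (hX : IsGeodesicSpace X) (h : dist x y < r.1) :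
    (ripsFunctor r).map (pathArrow (hX.geodesic x y)) = ripsEdge h := by
  obtain ⟨m, hm⟩ := hX.exists_range_geodesic_subset_ball h
  exact ripsFunctor_map_of_range_subset_ball _ hm h

theorem map_incl_ripsFunctor_map {p q : Set.Ioi (0 : ℝ)} (hpq : p ≤ q)
    {a b : FundamentalGroupoid X} (f : a ⟶ b) :
    (FundamentalGroupoid.map (incl (rips_mono hpq))).map ((ripsFunctor p).map f) =
      (ripsFunctor q).map f := by
  have natural := naturality_of_locally
    (F := ripsFunctor p ⋙ FundamentalGroupoid.map (incl (rips_mono hpq))) (G := ripsFunctor q)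
    (fun m : X => Metric.isOpen_ball) (exists_mem_ball_half p)
    (fun a => 𝟙 ((ripsFunctor q).obj a)) (fun x y γ m hγ => ?_) f
  · exact (Category.comp_id _).symm.trans (natural.trans (Category.id_comp _))
  · have small := dist_lt_of_mem_ball (hγ γ.source_mem_range) (hγ γ.target_mem_range)
    have half_le : p.1 / 2 ≤ q.1 / 2 := div_le_div_of_nonneg_right hpq zero_le_two
    rw [ripsFunctor_map_of_range_subset_ball γ (hγ.trans (Metric.ball_subset_ball half_le))
      (small.trans_le hpq), Functor.comp_map, ripsFunctor_map_of_range_subset_ball γ hγ small]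
    exact (Category.comp_id _).trans (Category.id_comp _).symm

end Rips

section ShortLoops

open Realization

variable {X : Type u} [MetricSpace X] {r : Set.Ioi (0 : ℝ)}

theorem IsGeodesicSpace.exists_mem_ball_third (hX : IsGeodesicSpace X) {x z : X} {s : ℝ}
    (h : dist z x < 3 * s / 2) : ∃ m, dist z m < s ∧ x ∈ Metric.ball m (s / 2) := by
  obtain ⟨m, hzm, hmx⟩ := hX.exists_dist_eq z x (a := 2 / 3 * dist z x) (by positivity)
    (by linarith [dist_nonneg (x := z) (y := x)])
  exact ⟨m, by linarith, by rw [Metric.mem_ball']; linarith⟩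

theorem dist_lt_of_mem_ball_half {a y : X} (h : y ∈ Metric.ball a (r.1 / 2)) : dist a y < r.1 :=
  (Metric.mem_ball'.1 h).trans (half_lt_self r.2)

theorem ripsEdge_comp_ripsEdge_eq {x z a b : X} (ha : dist z a < r.1) (hb : dist z b < r.1)
    (hax : x ∈ Metric.ball a (r.1 / 2)) (hbx : x ∈ Metric.ball b (r.1 / 2))
    (hax' : dist a x < r.1) (hbx' : dist b x < r.1) :
    ripsEdge ha ≫ ripsEdge hax' = ripsEdge hb ≫ ripsEdge hbx' := by
  have hab : dist a b < r.1 :=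
    dist_lt_of_mem_ball (Metric.mem_ball_comm.1 hax) (Metric.mem_ball_comm.1 hbx)
  rw [← ripsEdge_comp ha hab hb, Category.assoc, ripsEdge_comp hab hbx' hax']

theorem exists_cone_ball (hX : IsGeodesicSpace X) (z : X) (r : Set.Ioi (0 : ℝ)) :
    ∃ cone : ∀ y : Metric.ball z (3 * r.1 / 2), FundamentalGroupoid.mk (vertex (rips X r) z) ⟶
        FundamentalGroupoid.mk (vertex (rips X r) y),
      ∀ {a : X} (ha : dist z a < r.1) {y : Metric.ball z (3 * r.1 / 2)}
        (hay : y.1 ∈ Metric.ball a (r.1 / 2)),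
        cone y = ripsEdge ha ≫ ripsEdge (dist_lt_of_mem_ball_half hay) := by
  choose m hzm hym using fun y : Metric.ball z (3 * r.1 / 2) =>
    hX.exists_mem_ball_third (Metric.mem_ball'.1 y.2)
  exact ⟨fun y => ripsEdge (hzm y) ≫ ripsEdge (dist_lt_of_mem_ball_half (hym y)),
    fun ha y hay => ripsEdge_comp_ripsEdge_eq _ _ (hym y) hay _ _⟩

theorem range_subset_ball_of_diam_lt {x : X} {s : ℝ} (β : Path x x)
    (hβ : Metric.diam (Set.range β) < s) : Set.range β ⊆ Metric.ball x s := fun _ hy =>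
  (Metric.dist_le_diam_of_mem (isCompact_range β.continuous).isBounded hy
    β.source_mem_range).trans_lt hβ

variable [PathConnectedSpace X]

theorem ripsFunctor_map_eq_id_of_range_subset_ball (hX : IsGeodesicSpace X) {x z : X}
    (β : Path x x) (hβ : Set.range β ⊆ Metric.ball z (3 * r.1 / 2)) :
    (ripsFunctor r).map (pathArrow β) = 𝟙 _ := by
  obtain ⟨cone, cone_eq⟩ := exists_cone_ball hX z r
  let ballIncl : C(Metric.ball z (3 * r.1 / 2), X) := ⟨Subtype.val, continuous_subtype_val⟩
  let β' : Path (⟨x, hβ β.source_mem_range⟩ : Metric.ball z (3 * r.1 / 2))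
      ⟨x, hβ β.source_mem_range⟩ :=
    { toFun t := ⟨β t, hβ ⟨t, rfl⟩⟩
      source' := Subtype.ext β.source
      target' := Subtype.ext β.target }
  have cone_natural := comp_map_eq_of_locally
    (G := FundamentalGroupoid.map ballIncl ⋙ ripsFunctor r)
    (U := fun a : {a // dist z a < r.1} => Subtype.val ⁻¹' Metric.ball a.1 (r.1 / 2))
    (fun a => Metric.isOpen_ball.preimage continuous_subtype_val)
    (fun y => ?_) (fun y => cone y.as) (fun y y' p a hp => ?_) (pathArrow β')
  · exact (cancel_epi (cone _)).1 (cone_natural.trans (Category.comp_id _).symm)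
  · obtain ⟨m, hzm, hym⟩ := hX.exists_mem_ball_third (Metric.mem_ball'.1 y.2)
    exact ⟨⟨m, hzm⟩, hym⟩
  · have hy := hp p.source_mem_range
    have hy' := hp p.target_mem_range
    have edge_eq : (ripsFunctor r).map (pathArrow (p.map ballIncl.continuous)) =
        ripsEdge (dist_lt_of_mem_ball hy hy') :=
      ripsFunctor_map_of_range_subset_ball _ (Set.range_subset_iff.2 fun t => hp ⟨t, rfl⟩) _
    change cone y ≫ (ripsFunctor r).map (pathArrow (p.map ballIncl.continuous)) = cone y'
    rw [edge_eq, cone_eq a.2 hy, cone_eq a.2 hy']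
    exact (Category.assoc _ _ _).trans (congrArg _ (ripsEdge_comp _ _ _))

end ShortLoops

section Comparison

open Realization

variable {X : Type u} [MetricSpace X] {r : Set.Ioi (0 : ℝ)}
  (hX : IsGeodesicSpace X)

section ShortLoops

variable {Γ : Type*} [Group Γ] {d : ℝ} {T : FundamentalGroupoid X ⥤ SingleObj Γ}
  (hT : ∀ (x : X) (β : Path x x), Metric.diam (Set.range β) < d → T.map (pathArrow β) = (1 : Γ))

include hT in
theorem map_pathArrow_eq_of_diam_union_lt {x y : X} {p q : Path x y}
    (h : Metric.diam (Set.range p ∪ Set.range q) < d) :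
    T.map (pathArrow p) = T.map (pathArrow q) := by
  have trivial_loop := hT x (p.trans q.symm) (by rwa [Path.trans_range, Path.symm_range])
  rw [pathArrow_trans, pathArrow_symm, T.map_comp, T.map_inv, SingleObj.inv_as_inv,
    SingleObj.comp_as_mul, inv_mul_eq_one] at trivial_loop
  exact trivial_loop.symm

include hX hT in
theorem map_pathArrow_eq_map_geodesic (hd : 0 < d) {x y : X} (p : Path x y) (m : X)
    (hp : Set.range p ⊆ Metric.ball m (d / 8)) :
    T.map (pathArrow p) = T.map (pathArrow (hX.geodesic x y)) := by
  refine map_pathArrow_eq_of_diam_union_lt hT ?_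
  have subset_closedBall : Set.range p ∪ Set.range (hX.geodesic x y) ⊆
      Metric.closedBall m (3 * d / 8) := by
    refine Set.union_subset (hp.trans ((Metric.ball_subset_ball (by linarith)).trans
      Metric.ball_subset_closedBall)) fun z hz => ?_
    have hx := Metric.mem_ball.1 (hp p.source_mem_range)
    have hy := Metric.mem_ball.1 (hp p.target_mem_range)
    have := hX.dist_add_dist_of_mem_range hz
    rw [Metric.mem_closedBall]
    linarith [dist_triangle_left z m x, dist_triangle_right x y m, dist_nonneg (x := z) (y := y)]
  calc Metric.diam (Set.range p ∪ Set.range (hX.geodesic x y))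
      ≤ Metric.diam (Metric.closedBall m (3 * d / 8)) :=
        Metric.diam_mono subset_closedBall Metric.isBounded_closedBall
    _ ≤ 2 * (3 * d / 8) := Metric.diam_closedBall (by positivity)
    _ < d := by linarith

variable [PathConnectedSpace X]

include hX in
theorem exists_ripsFunctor_extension (hT : ∀ (x : X) (β : Path x x),
      Metric.diam (Set.range β) < 3 * r.1 / 2 → T.map (pathArrow β) = (1 : Γ)) :
    ∃ W : FundamentalGroupoid (Realization (rips X r)) ⥤ SingleObj Γ,
      ∀ {a b : FundamentalGroupoid X} (f : a ⟶ b),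
        (W.map ((ripsFunctor r).map f) : Γ) = T.map f := by
  have r_pos : 0 < r.1 := r.2
  obtain ⟨W, hW⟩ := exists_functor_of_cocycle (K := rips X r)
    (g := fun x y => (T.map (pathArrow (hX.geodesic x y)) : Γ)) fun x y z h => by
      have hxy := dist_lt_of_spansFace h (.inl rfl) (.inr (.inl rfl))
      have hyz := dist_lt_of_spansFace h (.inr (.inl rfl)) (.inr (.inr rfl))
      have hxz := dist_lt_of_spansFace h (.inl rfl) (.inr (.inr rfl))
      rw [← map_pathArrow_eq_of_diam_union_lt hT ((hX.diam_triangle_le x y z).trans_lt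
        (by linarith)), pathArrow_trans, T.map_comp, SingleObj.comp_as_mul]
  refine ⟨W, fun f => ?_⟩
  refine pathArrow_induction (U := fun m : X => Metric.ball m (3 * r.1 / 2 / 8))
    (fun m => Metric.isOpen_ball) (fun m => ⟨m, Metric.mem_ball_self (by positivity)⟩)
    (P := fun a b f => (W.map ((ripsFunctor r).map f) : Γ) = T.map f)
    (fun x y p m hp => ?_) (fun a b c f f' hf hf' => ?_) f
  · have hp' : Set.range p ⊆ Metric.ball m (r.1 / 2) :=
      hp.trans (Metric.ball_subset_ball (by linarith))
    have hxy := dist_lt_of_mem_ball (hp' p.source_mem_range) (hp' p.target_mem_range)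
    rw [ripsFunctor_map_of_range_subset_ball p hp' hxy,
      map_pathArrow_eq_map_geodesic hX hT (by positivity) p m hp]
    exact hW x y _
  · rw [Functor.map_comp, Functor.map_comp, Functor.map_comp, SingleObj.comp_as_mul,
      SingleObj.comp_as_mul, hf, hf']

end ShortLoops

variable [PathConnectedSpace X]

include hX in
theorem exists_ripsFunctor_map_eq_of_support {u u' : FundamentalGroupoid (Realization (rips X r))}
    (f : u ⟶ u') (a b : X) (ha : a ∈ u.as.support) (hb : b ∈ u'.as.support) :
    ∃ q : FundamentalGroupoid.mk a ⟶ FundamentalGroupoid.mk b,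
      toVertex u.as a ha ≫ (ripsFunctor r).map q = f ≫ toVertex u'.as b hb := by
  refine pathArrow_induction isOpen_openStar (fun x => ⟨x.someVertex, x.someVertex_mem⟩)
    (P := fun u u' f => ∀ (a b : X) (ha : a ∈ u.as.support) (hb : b ∈ u'.as.support),
      ∃ q : FundamentalGroupoid.mk a ⟶ FundamentalGroupoid.mk b,
        toVertex u.as a ha ≫ (ripsFunctor r).map q = f ≫ toVertex u'.as b hb) ?_ ?_ f a b ha hb
  · intro u u' p v hp a b ha hb
    have hu : v ∈ u.support := hp p.source_mem_range
    have hu' : v ∈ u'.support := hp p.target_mem_range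
    have hav := dist_lt_of_spansFace u.spansFace_support ha hu
    have hvb := dist_lt_of_spansFace u'.spansFace_support hu' hb
    refine ⟨pathArrow (hX.geodesic a v) ≫ pathArrow (hX.geodesic v b), ?_⟩
    rw [Functor.map_comp, ripsFunctor_map_geodesic hX hav, ripsFunctor_map_geodesic hX hvb,
      pathArrow_of_range_subset_openStar p hp hu hu']
    have e₁ : toVertex u a ha ≫ ripsEdge hav = toVertex u v hu := toVertex_comp_edge _ _ _
    have e₂ : toVertex u' v hu' ≫ ripsEdge hvb = toVertex u' b hb := toVertex_comp_edge _ _ _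
    rw [← e₂, Category.assoc, IsIso.inv_hom_id_assoc]
    exact (Category.assoc _ _ _).symm.trans (congrArg (· ≫ _) e₁)
  · intro u u' u'' f f' hf hf' a b ha hb
    obtain ⟨q, hq⟩ := hf a _ ha u'.as.someVertex_mem
    obtain ⟨q', hq'⟩ := hf' _ b u'.as.someVertex_mem hb
    refine ⟨q ≫ q', ?_⟩
    rw [Functor.map_comp]
    exact (Category.assoc _ _ _).symm.trans <| (congrArg (· ≫ _) hq).trans <|
      (Category.assoc _ _ _).trans <| (congrArg (f ≫ ·) hq').trans (Category.assoc _ _ _).symm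

include hX in
theorem exists_ripsFunctor_map_eq {x y : X}
    (f : FundamentalGroupoid.mk (vertex (rips X r) x) ⟶
      FundamentalGroupoid.mk (vertex (rips X r) y)) :
    ∃ q : FundamentalGroupoid.mk x ⟶ FundamentalGroupoid.mk y, (ripsFunctor r).map q = f := by
  have mem (v : X) : v ∈ (vertex (rips X r) v).support := by simp [support_vertex]
  have toVertex_self (v : X) : toVertex _ v (mem v) = 𝟙 _ :=
    edge_self v (spansFace_rips_pair ((dist_self v).trans_lt r.2))
  obtain ⟨q, hq⟩ := exists_ripsFunctor_map_eq_of_support hX f x y (mem x) (mem y)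
  rw [toVertex_self, toVertex_self] at hq
  exact ⟨q, (Category.id_comp _).symm.trans (hq.trans (Category.comp_id _))⟩

end Comparison

section PiOneRips

variable {X : Type u} [MetricSpace X] {r : Set.Ioi (0 : ℝ)}

theorem fromPath_lasso {Y : Type*} [TopologicalSpace Y] {x₀ x : Y} (α : Path x₀ x) (β : Path x x) :
    FundamentalGroup.fromPath (Path.Homotopic.Quotient.mk ((α.trans β).trans α.symm)) =
      (pathArrow α ≫ pathArrow β ≫ inv (pathArrow α) :) := by
  rw [← pathArrow_symm, ← Category.assoc]
  rfl

section

variable [PathConnectedSpace X]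

/-- The homomorphism from the fundamental group of a space to that of its Rips complex. -/
noncomputable def piOneRips (r : Set.Ioi (0 : ℝ)) (x₀ : X) :
    FundamentalGroup X x₀ →*
      FundamentalGroup (Realization (rips X r)) (Realization.vertex (rips X r) x₀) :=
  (ripsFunctor r).mapEnd (FundamentalGroupoid.mk x₀)

variable (hX : IsGeodesicSpace X) (x₀ : X)

theorem piOneIncl_piOneRips {p q : Set.Ioi (0 : ℝ)} (hpq : p ≤ q) (γ : FundamentalGroup X x₀) :
    piOneIncl (rips_mono hpq) x₀ (piOneRips p x₀ γ) = piOneRips q x₀ γ :=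
  map_incl_ripsFunctor_map hpq γ

include hX

theorem piOneRips_surjective : Function.Surjective (piOneRips r x₀) :=
  exists_ripsFunctor_map_eq hX

theorem diamPiOne_le_ker : diamPiOne x₀ (3 * r.1 / 2) ≤ (piOneRips r x₀).ker := by
  refine (Subgroup.closure_le _).2 ?_
  rintro _ ⟨x, α, β, hβ, rfl⟩
  have β_trivial := ripsFunctor_map_eq_id_of_range_subset_ball (r := r) hX β
    (range_subset_ball_of_diam_lt β hβ)
  rw [fromPath_lasso]
  change (ripsFunctor r).map (pathArrow α ≫ pathArrow β ≫ inv (pathArrow α)) = 𝟙 _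
  rw [Functor.map_comp, Functor.map_comp, β_trivial, Category.id_comp, Functor.map_inv,
    IsIso.hom_inv_id]

theorem ker_le_diamPiOne : (piOneRips r x₀).ker ≤ diamPiOne x₀ (3 * r.1 / 2) := by
  classical
  obtain ⟨e, he⟩ : ∃ e : ∀ a : FundamentalGroupoid X, FundamentalGroupoid.mk x₀ ⟶ a,
      e (FundamentalGroupoid.mk x₀) = 𝟙 _ :=
    ⟨Function.update (fun a => pathArrow (PathConnectedSpace.somePath x₀ a.as)) _ (𝟙 _),
      Function.update_self ..⟩
  obtain ⟨W, hW⟩ := exists_ripsFunctor_extension hX (r := r)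
    (T := vertexRetraction e ⋙ (QuotientGroup.mk' (diamPiOne x₀ (3 * r.1 / 2))).toFunctor)
    fun x β hβ => by
      obtain ⟨α, hα⟩ := pathArrow_surjective (e ⟨x⟩)
      refine (QuotientGroup.eq_one_iff _).2 (Subgroup.subset_closure ⟨x, α, β, hβ, ?_⟩)
      rw [fromPath_lasso, hα]
      rfl
  intro γ hγ
  have γ_trivial : (ripsFunctor r).map γ = 𝟙 _ := hγ
  refine (QuotientGroup.eq_one_iff γ).1 ?_
  calc (γ : FundamentalGroup X x₀ ⧸ diamPiOne x₀ (3 * r.1 / 2))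
      = ((vertexRetraction e).map γ : End _) := by rw [vertexRetraction_map_eq_self he]
    _ = W.map ((ripsFunctor r).map γ) := (hW γ).symm
    _ = 1 := by rw [γ_trivial, W.map_id]; rfl

/-- The isomorphism from the fundamental group of the Rips complex to the quotient of the
fundamental group of `X` by the lassos of small diameter. -/
noncomputable def piOneRipsEquiv (r : Set.Ioi (0 : ℝ)) :
    FundamentalGroup (Realization (rips X r)) (Realization.vertex (rips X r) x₀) ≃*
      FundamentalGroup X x₀ ⧸ diamPiOne x₀ (3 * r.1 / 2) :=
  ((QuotientGroup.quotientMulEquivOfEq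
    ((diamPiOne_le_ker hX x₀).antisymm (ker_le_diamPiOne hX x₀))).trans
    (QuotientGroup.quotientKerEquivOfSurjective _ (piOneRips_surjective hX x₀))).symm

theorem piOneRipsEquiv_piOneRips (γ : FundamentalGroup X x₀) :
    piOneRipsEquiv hX x₀ r (piOneRips r x₀ γ) = QuotientGroup.mk γ :=
  (MulEquiv.symm_apply_eq _).2 rfl

end

theorem exists_piOneRipsEquiv (hX : IsGeodesicSpace X) (x₀ : X) :
    ∃ f : ∀ r : Set.Ioi (0 : ℝ),
        FundamentalGroup (Realization (rips X r)) (Realization.vertex (rips X r) x₀) ≃*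
          FundamentalGroup X x₀ ⧸ diamPiOne x₀ (3 * r.1 / 2),
      ∀ (p q : Set.Ioi (0 : ℝ)) (hpq : p ≤ q)
        (c : FundamentalGroup (Realization (rips X p)) (Realization.vertex (rips X p) x₀)),
        f q (piOneIncl (rips_mono hpq) x₀ c) = diamPiOneProj x₀ (scale_mono hpq) (f p c) := by
  have : Nonempty X := ⟨x₀⟩
  have : PathConnectedSpace X := hX.pathConnectedSpace
  refine ⟨piOneRipsEquiv hX x₀, fun p q hpq c => ?_⟩
  obtain ⟨γ, rfl⟩ := piOneRips_surjective hX x₀ c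
  rw [piOneIncl_piOneRips x₀ hpq, piOneRipsEquiv_piOneRips, piOneRipsEquiv_piOneRips]
  rfl

end PiOneRips

section PathCocycle

variable {Y : Type*} [TopologicalSpace Y] {M : Type*} [AddCommGroup M]

/-- A 1-cocycle on the fundamental groupoid of `Y` with values in the abelian group `M`: it assigns
an element of `M` to each homotopy class of paths, additively under concatenation. -/
abbrev PathCocycle (Y : Type*) [TopologicalSpace Y] (M : Type*) [AddCommGroup M] :=
  FundamentalGroupoid Y ⥤ SingleObj (Multiplicative M)

/-- The value of a cocycle on an arrow of the fundamental groupoid, in additive notation. -/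
def PathCocycle.eval (T : PathCocycle Y M) {a b : FundamentalGroupoid Y} (f : a ⟶ b) : M :=
  (T.map f : Multiplicative M).toAdd

namespace PathCocycle

variable (T : PathCocycle Y M)

theorem eval_id (a : FundamentalGroupoid Y) : T.eval (𝟙 a) = 0 :=
  congrArg Multiplicative.toAdd (T.map_id a)

theorem eval_comp {a b c : FundamentalGroupoid Y} (f : a ⟶ b) (g : b ⟶ c) :
    T.eval (f ≫ g) = T.eval f + T.eval g :=
  (congrArg Multiplicative.toAdd (T.map_comp f g)).trans (add_comm (T.eval g) (T.eval f))

theorem eval_inv {a b : FundamentalGroupoid Y} (f : a ⟶ b) : T.eval (inv f) = -T.eval f := by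
  rw [eq_neg_iff_add_eq_zero, ← eval_comp, IsIso.inv_hom_id, eval_id]

theorem eval_pathArrow_congr {x y x' y' : Y} {p : Path x y} {q : Path x' y'}
    (h : ∀ t, p t = q t) : T.eval (pathArrow p) = T.eval (pathArrow q) := by
  obtain rfl : x = x' := by simpa using h 0
  obtain rfl : y = y' := by simpa using h 1
  rw [Path.ext (funext h)]

theorem exists_eval_eq_sub [SimplyConnectedSpace Y] :
    ∃ b : Y → M, ∀ {x y : Y} (p : Path x y), T.eval (pathArrow p) = b y - b x := by
  have base := PathConnectedSpace.somePath (Classical.arbitrary Y)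
  refine ⟨fun y => T.eval (pathArrow (base y)), fun {x y} p => ?_⟩
  have homotopic := SimplyConnectedSpace.paths_homotopic (base y) ((base x).trans p)
  beta_reduce
  rw [pathArrow_eq_of_homotopic homotopic, pathArrow_trans, eval_comp, add_sub_cancel_left]

end PathCocycle

end PathCocycle

local notation "Sing(" Y ")" => TopCat.toSSet.obj (TopCat.of Y)

section SingularSimplices

open scoped Simplicial

variable {Y : Type u} [TopologicalSpace Y] {x y : Y}

/-- The singular simplex given by a continuous map. -/
noncomputable def simplexOf {n : ℕ} (f : C(stdSimplex ℝ (Fin (n + 1)), Y)) :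
    Sing(Y) _⦋n⦌ :=
  (TopCat.toSSetObjEquiv (TopCat.of Y) (Opposite.op ⦋n⦌)).symm f

theorem exists_simplexOf_eq {n : ℕ} (σ : Sing(Y) _⦋n⦌) :
    ∃ f : C(stdSimplex ℝ (Fin (n + 1)), Y), simplexOf f = σ :=
  ⟨TopCat.toSSetObjEquiv (TopCat.of Y) (Opposite.op ⦋n⦌) σ, Equiv.symm_apply_apply _ _⟩

/-- The inclusion of the `i`-th face of the standard simplex. -/
noncomputable def faceMap {n : ℕ} (i : Fin (n + 2)) :
    C(stdSimplex ℝ (Fin (n + 1)), stdSimplex ℝ (Fin (n + 2))) :=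
  ⟨stdSimplex.map i.succAbove, stdSimplex.continuous_map _⟩

theorem faceMap_vertex {n : ℕ} (i : Fin (n + 2)) (j : Fin (n + 1)) :
    faceMap i (stdSimplex.vertex j) = stdSimplex.vertex (i.succAbove j) :=
  stdSimplex.map_vertex _ _

theorem sum_faceMap_smul {n : ℕ} (i : Fin (n + 2)) (s : stdSimplex ℝ (Fin (n + 1)))
    {E : Type*} [AddCommGroup E] [Module ℝ E] (v : Fin (n + 2) → E) :
    ∑ k, faceMap i s k • v k = ∑ j, s j • v (i.succAbove j) := by
  have apply_succAbove (j) : faceMap i s (i.succAbove j) = s j := by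
    simp [faceMap, FunOnFinite.linearMap_apply_apply, Finset.sum_filter]
  have apply_self : faceMap i s i = 0 := by
    simp [faceMap, FunOnFinite.linearMap_apply_apply, Fin.succAbove_ne]
  rw [Fin.sum_univ_succAbove _ i, apply_self, zero_smul, zero_add]
  simp only [apply_succAbove]

theorem delta_simplexOf {n : ℕ} (f : C(stdSimplex ℝ (Fin (n + 2)), Y)) (i : Fin (n + 2)) :
    Sing(Y).δ i (simplexOf f) = simplexOf (f.comp (faceMap i)) :=
  rfl

/-- The path in the standard 1-simplex from one vertex to the other. -/
noncomputable def simplexPath :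
    Path (stdSimplex.vertex (S := ℝ) (0 : Fin 2)) (stdSimplex.vertex (1 : Fin 2)) where
  toFun := stdSimplexHomeomorphUnitInterval.symm
  source' := by
    rw [Homeomorph.symm_apply_eq]
    exact stdSimplexHomeomorphUnitInterval_zero.symm
  target' := by
    rw [Homeomorph.symm_apply_eq]
    exact stdSimplexHomeomorphUnitInterval_one.symm

theorem pathSimplex_map_simplexPath (f : C(stdSimplex ℝ (Fin 2), Y)) :
    pathSimplex (simplexPath.map f.continuous) = simplexOf f :=
  congrArg simplexOf <| ContinuousMap.ext fun s =>
    congrArg f (stdSimplexHomeomorphUnitInterval.symm_apply_apply s)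

theorem exists_pathSimplex_eq (σ : Sing(Y) _⦋1⦌) :
    ∃ (x y : Y) (p : Path x y), pathSimplex p = σ := by
  obtain ⟨f, rfl⟩ := exists_simplexOf_eq σ
  exact ⟨_, _, _, pathSimplex_map_simplexPath f⟩

theorem apply_eq_of_pathSimplex_eq {x' y' : Y} {p : Path x y} {q : Path x' y'}
    (h : pathSimplex p = pathSimplex q) (t : I) : p t = q t := by
  have h' := DFunLike.congr_fun
    ((TopCat.toSSetObjEquiv (TopCat.of Y) (Opposite.op ⦋1⦌)).symm.injective h)
    (stdSimplexHomeomorphUnitInterval.symm t)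
  change p (stdSimplexHomeomorphUnitInterval _) = q (stdSimplexHomeomorphUnitInterval _) at h'
  rwa [Homeomorph.apply_symm_apply] at h'

theorem delta_pathSimplex_eq (p : Path x y) (i : Fin 2) :
    Sing(Y).δ i (pathSimplex p) = TopCat.toSSetObj₀Equiv.symm
      (p (stdSimplexHomeomorphUnitInterval (stdSimplex.vertex (i.succAbove 0)))) := by
  rw [Equiv.eq_symm_apply, ← faceMap_vertex,
    Subsingleton.elim (stdSimplex.vertex 0) (default : stdSimplex ℝ (Fin 1))]
  rfl

theorem delta_zero_pathSimplex (p : Path x y) :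
    Sing(Y).δ 0 (pathSimplex p) = TopCat.toSSetObj₀Equiv.symm y :=
  (delta_pathSimplex_eq p 0).trans (congrArg _ (by simp))

theorem delta_one_pathSimplex (p : Path x y) :
    Sing(Y).δ 1 (pathSimplex p) = TopCat.toSSetObj₀Equiv.symm x :=
  (delta_pathSimplex_eq p 1).trans (congrArg _ (by simp))

end SingularSimplices

section Chains

open scoped Simplicial

variable {Y : Type u} [TopologicalSpace Y] {x y z : Y} (G : Type u) [AddCommGroup G]

variable (Y) in
/-- The complex of singular chains with coefficients in `G`. -/
noncomputable abbrev chains : ChainComplex AddCommGrpCat.{u} ℕ :=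
  Sing(Y).chainComplex (AddCommGrpCat.of G)

variable {G} in
/-- The homomorphism on singular chains that takes prescribed values on simplices. -/
noncomputable def chainDesc {n : ℕ} {A : AddCommGrpCat.{u}}
    (w : Sing(Y) _⦋n⦌ → (AddCommGrpCat.of G ⟶ A)) :
    (chains Y G).X n ⟶ A :=
  Limits.Cofan.IsColimit.desc
    (SSet.isColimitChainComplexXCofan Sing(Y) (AddCommGrpCat.of G) n) w

theorem ι_chainDesc {n : ℕ} {A : AddCommGrpCat.{u}}
    (w : Sing(Y) _⦋n⦌ → (AddCommGrpCat.of G ⟶ A))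
    (σ : Sing(Y) _⦋n⦌) :
    SSet.ιChainComplex Sing(Y) σ ≫ chainDesc w = w σ :=
  Limits.Cofan.IsColimit.fac _ _ σ

theorem ι_d_two_one_comp (σ : Sing(Y) _⦋2⦌) {A : AddCommGrpCat.{u}}
    (w : (chains Y G).X 1 ⟶ A) :
    SSet.ιChainComplex Sing(Y) σ ≫ (chains Y G).d 2 1 ≫ w =
      SSet.ιChainComplex _ (Sing(Y).δ 2 σ) ≫ w +
        SSet.ιChainComplex _ (Sing(Y).δ 0 σ) ≫ w -
        SSet.ιChainComplex _ (Sing(Y).δ 1 σ) ≫ w := by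
  rw [SSet.ιChainComplex_d_assoc, Fin.sum_univ_three]
  simp only [Fin.val_zero, Fin.val_one, Fin.val_two, pow_zero, pow_one,
    one_smul, neg_smul, Preadditive.add_comp, Preadditive.neg_comp, even_two, Even.neg_pow,
    one_pow]
  abel

theorem ι_pathSimplex_d_comp (p : Path x y) {A : AddCommGrpCat.{u}} (w : (chains Y G).X 0 ⟶ A) :
    SSet.ιChainComplex Sing(Y) (pathSimplex p) ≫ (chains Y G).d 1 0 ≫ w =
      SSet.ιChainComplex _ (TopCat.toSSetObj₀Equiv.symm y) ≫ w -
        SSet.ιChainComplex _ (TopCat.toSSetObj₀Equiv.symm x) ≫ w := by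
  rw [SSet.ιChainComplex_d_assoc, Fin.sum_univ_two, delta_zero_pathSimplex, delta_one_pathSimplex]
  simp only [Fin.val_zero, Fin.val_one, pow_zero, pow_one, one_smul, neg_smul,
    Preadditive.add_comp, Preadditive.neg_comp, sub_eq_add_neg]

/-- The class of the 1-chain `g • p` modulo boundaries. -/
noncomputable def pathClass (p : Path x y) :
    AddCommGrpCat.of G ⟶ (chains Y G).opcycles 1 :=
  SSet.ιChainComplex Sing(Y) (pathSimplex p) ≫ (chains Y G).pOpcycles 1

theorem pathClass_of_triangle {E : Type*} [AddCommGroup E] [Module ℝ E] [TopologicalSpace E]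
    [ContinuousAdd E] [ContinuousSMul ℝ E] (f : C(E, Y)) (a b c : E) {p : Path x y} {q : Path y z}
    {s : Path x z} (hp : ∀ t : I, p t = f (AffineMap.lineMap a b (t : ℝ)))
    (hq : ∀ t : I, q t = f (AffineMap.lineMap b c (t : ℝ)))
    (hs : ∀ t : I, s t = f (AffineMap.lineMap a c (t : ℝ))) :
    pathClass G s = pathClass G p + pathClass G q := by
  let τ : C(stdSimplex ℝ (Fin 3), Y) :=
    ⟨fun v => f (∑ i, v i • ![a, b, c] i), f.continuous.comp <| continuous_finsetSum _ fun i _ =>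
      ((continuous_apply i).comp continuous_subtype_val).smul continuous_const⟩
  have face (i : Fin 3) {x' y' : Y} (p' : Path x' y') (h : ∀ t : I, p' t =
      f (AffineMap.lineMap (![a, b, c] (i.succAbove 0)) (![a, b, c] (i.succAbove 1)) (t : ℝ))) :
      Sing(Y).δ i (simplexOf τ) = pathSimplex p' := by
    refine (delta_simplexOf τ i).trans (congrArg simplexOf (ContinuousMap.ext fun v => ?_))
    refine (congrArg f (sum_faceMap_smul i v _)).trans (.trans ?_ (h _).symm)
    rw [Fin.sum_univ_two, AffineMap.lineMap_apply_module,
      eq_sub_of_add_eq (stdSimplex.add_eq_one v)]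
    rfl
  have boundary := ι_d_two_one_comp G (simplexOf τ) ((chains Y G).pOpcycles 1)
  rw [HomologicalComplex.d_pOpcycles, Limits.comp_zero, face 2 p hp, face 0 q hq,
    face 1 s hs] at boundary
  exact (sub_eq_zero.1 boundary.symm).symm

theorem pathClass_trans (p : Path x y) (q : Path y z) :
    pathClass G (p.trans q) = pathClass G p + pathClass G q := by
  refine pathClass_of_triangle G ⟨(p.trans q).extend, (p.trans q).continuous_extend⟩
    (0 : ℝ) (1 / 2) 1 (fun t => ?_) (fun t => ?_) (fun t => ?_)
  · have ht := t.2.2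
    change _ = (p.trans q).extend _
    rw [AffineMap.lineMap_apply_ring', Path.extend_trans_of_le_half _ _ (by linarith),
      ← Path.extend_extends' p]
    congr 1
    ring
  · have ht := t.2.1
    change _ = (p.trans q).extend _
    rw [AffineMap.lineMap_apply_ring', Path.extend_trans_of_half_le _ _ (by linarith),
      ← Path.extend_extends' q]
    congr 1
    ring
  · simp [AffineMap.lineMap_apply]

theorem pathClass_refl (x : Y) : pathClass G (Path.refl x) = 0 := by
  have h := pathClass_trans G (Path.refl x) (Path.refl x)
  rw [Path.refl_trans_refl] at h
  exact left_eq_add.1 h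

theorem pathClass_eq_of_homotopic {p q : Path x y} (h : p.Homotopic q) :
    pathClass G p = pathClass G q := by
  obtain ⟨H⟩ := h
  let f : C(ℝ × ℝ, Y) :=
    ⟨fun v => H (Set.projIcc 0 1 zero_le_one v.1, Set.projIcc 0 1 zero_le_one v.2), by fun_prop⟩
  let diagonal : Path x y :=
    { toFun := fun t => H (t, t)
      continuous_toFun := by fun_prop
      source' := by simp
      target' := by simp }
  have upper : pathClass G diagonal = pathClass G p + pathClass G (Path.refl y) :=
    pathClass_of_triangle G f (0, 0) (0, 1) (1, 1) (fun t => by simp [f, AffineMap.lineMap_apply])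
      (fun t => by simp [f, AffineMap.lineMap_apply])
      (fun t => by simp [f, diagonal, AffineMap.lineMap_apply])
  have lower : pathClass G diagonal = pathClass G (Path.refl x) + pathClass G q :=
    pathClass_of_triangle G f (0, 0) (1, 0) (1, 1) (fun t => by simp [f, AffineMap.lineMap_apply])
      (fun t => by simp [f, AffineMap.lineMap_apply])
      (fun t => by simp [f, diagonal, AffineMap.lineMap_apply])
  rw [pathClass_refl, add_zero] at upper
  rw [pathClass_refl, zero_add] at lower
  exact upper.symm.trans lower

variable (Y) in
/-- The tautological cocycle: a path is sent to the class modulo boundaries of the 1-chain it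
spans. -/
noncomputable def chainCocycle : PathCocycle Y (AddCommGrpCat.of G ⟶ (chains Y G).opcycles 1) where
  obj _ := SingleObj.star _
  map f := Multiplicative.ofAdd (Quotient.lift (fun p => pathClass G p)
    (fun _ _ h => pathClass_eq_of_homotopic G h) f)
  map_id a := congrArg Multiplicative.ofAdd (pathClass_refl G a.as)
  map_comp {a b c} f g := by
    obtain ⟨p, rfl⟩ := pathArrow_surjective f
    obtain ⟨q, rfl⟩ := pathArrow_surjective g
    exact congrArg Multiplicative.ofAdd ((pathClass_trans G p q).trans (add_comm _ _))

theorem eval_chainCocycle (p : Path x y) : (chainCocycle Y G).eval (pathArrow p) = pathClass G p :=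
  rfl

theorem chainCocycle_universal {A : AddCommGrpCat.{u}}
    (T : PathCocycle Y (AddCommGrpCat.of G ⟶ A)) :
    ∃ φ : (chains Y G).opcycles 1 ⟶ A,
      ∀ {x y : Y} (p : Path x y), pathClass G p ≫ φ = T.eval (pathArrow p) := by
  choose source target path h_path using exists_pathSimplex_eq (Y := Y)
  let w : (chains Y G).X 1 ⟶ A := chainDesc fun σ => T.eval (pathArrow (path σ))
  have ι_w {x y : Y} (p : Path x y) :
      SSet.ιChainComplex Sing(Y) (pathSimplex p) ≫ w =
        T.eval (pathArrow p) :=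
    (ι_chainDesc G _ _).trans
      (T.eval_pathArrow_congr (apply_eq_of_pathSimplex_eq (h_path (pathSimplex p))))
  have d_w : (chains Y G).d 2 1 ≫ w = 0 := by
    refine SSet.chainComplex_hom_ext fun σ => ?_
    obtain ⟨τ, rfl⟩ := exists_simplexOf_eq σ
    have : ContractibleSpace (stdSimplex ℝ (Fin 3)) :=
      (convex_stdSimplex ℝ _).contractibleSpace ⟨_, single_mem_stdSimplex ℝ 0⟩
    obtain ⟨b, hb⟩ := PathCocycle.exists_eval_eq_sub (FundamentalGroupoid.map τ ⋙ T)
    have face (i : Fin 3) : SSet.ιChainComplex Sing(Y)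
        (Sing(Y).δ i (simplexOf τ)) ≫ w =
          b (stdSimplex.vertex (i.succAbove 1)) - b (stdSimplex.vertex (i.succAbove 0)) := by
      rw [delta_simplexOf, ← pathSimplex_map_simplexPath, ι_w, ← faceMap_vertex,
        ← faceMap_vertex]
      exact hb (simplexPath.map (faceMap i).continuous)
    rw [ι_d_two_one_comp, Limits.comp_zero, face, face, face]
    change b (stdSimplex.vertex 1) - b (stdSimplex.vertex 0) +
      (b (stdSimplex.vertex 2) - b (stdSimplex.vertex 1)) -
      (b (stdSimplex.vertex 2) - b (stdSimplex.vertex 0)) = 0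
    abel
  refine ⟨(chains Y G).descOpcycles w 2 (by simp) d_w, fun p => ?_⟩
  rw [pathClass, Category.assoc, HomologicalComplex.p_descOpcycles, ι_w]

end Chains

section Homology

open scoped Simplicial

variable {Y : Type u} [TopologicalSpace Y] {x y z : Y} (G : Type u) [AddCommGroup G]

/-- The class of a loop, as a morphism to the first homology. -/
noncomputable def loopHom (β : Path x x) : AddCommGrpCat.of G ⟶ (chains Y G).homology 1 :=
  AddCommGrpCat.ofHom (loopClass G β)

theorem loopHom_homologyι (β : Path x x) :
    loopHom G β ≫ (chains Y G).homologyι 1 = pathClass G β := by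
  refine (Category.assoc _ _ _).trans ?_
  erw [HomologicalComplex.homology_π_ι]
  erw [HomologicalComplex.liftCycles_i_assoc]
  rfl

theorem exists_hOne_hom_of_cocycle {A : Type u} [AddCommGroup A] (T : PathCocycle Y (G →+ A)) :
    ∃ φ : HOne G Y →+ A,
      ∀ {x : Y} (β : Path x x), φ.comp (loopClass G β) = T.eval (pathArrow β) := by
  let T' : PathCocycle Y (AddCommGrpCat.of G ⟶ AddCommGrpCat.of A) :=
    T ⋙ (AddMonoidHom.toMultiplicative
      AddCommGrpCat.homAddEquiv.symm.toAddMonoidHom).toFunctor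
  obtain ⟨ψ, hψ⟩ := chainCocycle_universal G T'
  refine ⟨((chains Y G).homologyι 1 ≫ ψ).hom, fun β => ?_⟩
  have h : loopHom G β ≫ (chains Y G).homologyι 1 ≫ ψ = T'.eval (pathArrow β) := by
    rw [← Category.assoc, loopHom_homologyι, hψ]
  exact congrArg AddCommGrpCat.Hom.hom h

/-- A path to `y` from the chosen representative of its path component. -/
noncomputable def componentPath (y : Y) : Path (Quotient.mk (pathSetoid Y) y).out y :=
  Joined.somePath (Quotient.mk_out (s := pathSetoid Y) y)

theorem exists_loopHom_homologyι_eq (p : Path x y) :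
    ∃ (b : Y) (β : Path b b), loopHom G β ≫ (chains Y G).homologyι 1 =
      pathClass G (componentPath x) + pathClass G p - pathClass G (componentPath y) := by
  let back := (componentPath y).symm.cast rfl (congrArg Quotient.out (Quotient.sound ⟨p⟩))
  have pathClass_back : pathClass G back = -pathClass G (componentPath y) := calc
    pathClass G back = (chainCocycle Y G).eval (pathArrow (componentPath y).symm) :=
      (chainCocycle Y G).eval_pathArrow_congr fun _ => rfl
    _ = -pathClass G (componentPath y) := by
      rw [pathArrow_symm, PathCocycle.eval_inv, eval_chainCocycle]
  refine ⟨_, ((componentPath x).trans p).trans back, ?_⟩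
  rw [loopHom_homologyι, pathClass_trans, pathClass_trans, pathClass_back, sub_eq_add_neg]

theorem exists_hurewiczCocycle :
    ∃ H : PathCocycle Y (G →+ HOne G Y),
      ∀ {x : Y} (β : Path x x), H.eval (pathArrow β) = loopClass G β := by
  let offset (y : Y) := pathClass G (componentPath y)
  have exists_lift {a b : FundamentalGroupoid Y} (f : a ⟶ b) :
      ∃ h : AddCommGrpCat.of G ⟶ (chains Y G).homology 1, h ≫ (chains Y G).homologyι 1 =
        offset a.as + (chainCocycle Y G).eval f - offset b.as := by
    obtain ⟨p, rfl⟩ := pathArrow_surjective f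
    obtain ⟨_, β, hβ⟩ := exists_loopHom_homologyι_eq G p
    exact ⟨_, hβ⟩
  choose lift h_lift using @exists_lift
  refine ⟨{
    obj := fun _ => SingleObj.star _
    map := fun f => Multiplicative.ofAdd (lift f).hom
    map_id := fun a => ?_
    map_comp := fun f g => ?_ }, fun {x} β => ?_⟩
  · have h : lift (𝟙 a) = 0 := by
      rw [← cancel_mono ((chains Y G).homologyι 1), h_lift, PathCocycle.eval_id, add_zero,
        sub_self, Limits.zero_comp]
    exact congrArg (fun h => Multiplicative.ofAdd (AddCommGrpCat.Hom.hom h)) h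
  · have h : lift (f ≫ g) = lift g + lift f := by
      rw [← cancel_mono ((chains Y G).homologyι 1), Preadditive.add_comp, h_lift, h_lift, h_lift,
        PathCocycle.eval_comp]
      abel
    exact congrArg (fun h => Multiplicative.ofAdd (AddCommGrpCat.Hom.hom h)) h
  · have h : lift (pathArrow β) = loopHom G β := by
      rw [← cancel_mono ((chains Y G).homologyι 1), h_lift, loopHom_homologyι, eval_chainCocycle,
        add_sub_cancel_left]
    exact congrArg AddCommGrpCat.Hom.hom h

theorem exists_loopHom_factorization :
    ∃ (b : Sing(Y) _⦋1⦌ → Y)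
      (β : ∀ σ, Path (b σ) (b σ)),
      (chains Y G).iCycles 1 ≫ chainDesc (fun σ => loopHom G (β σ)) =
        (chains Y G).homologyπ 1 := by
  choose source target path h_path using exists_pathSimplex_eq (Y := Y)
  choose b β hβ using fun σ => exists_loopHom_homologyι_eq G (path σ)
  let offset : (chains Y G).X 0 ⟶ (chains Y G).opcycles 1 :=
    chainDesc fun σ => pathClass G (componentPath (TopCat.toSSetObj₀Equiv σ))
  have ι_offset (y : Y) : SSet.ιChainComplex _ (TopCat.toSSetObj₀Equiv.symm y) ≫ offset =
      pathClass G (componentPath y) :=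
    (ι_chainDesc G _ _).trans (by rw [Equiv.apply_symm_apply])
  have homologyι_eq : chainDesc (fun σ => loopHom G (β σ)) ≫ (chains Y G).homologyι 1 =
      (chains Y G).pOpcycles 1 - (chains Y G).d 1 0 ≫ offset := by
    refine SSet.chainComplex_hom_ext fun σ => ?_
    have d_offset := ι_pathSimplex_d_comp G (path σ) offset
    rw [ι_offset, ι_offset] at d_offset
    have pathClass_path : pathClass G (path σ) =
        SSet.ιChainComplex Sing(Y) σ ≫ (chains Y G).pOpcycles 1 := by rw [pathClass, h_path]
    rw [h_path] at d_offset
    rw [← Category.assoc, ι_chainDesc, hβ, Preadditive.comp_sub, d_offset, pathClass_path]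
    abel
  refine ⟨b, β, ?_⟩
  rw [← cancel_mono ((chains Y G).homologyι 1), Category.assoc, homologyι_eq, Preadditive.comp_sub,
    HomologicalComplex.iCycles_d_assoc, Limits.zero_comp, sub_zero,
    HomologicalComplex.homology_π_ι]

variable {G}

theorem hOne_hom_ext {A : Type u} [AddCommGroup A] {φ ψ : HOne G Y →+ A}
    (h : ∀ {x : Y} (β : Path x x), φ.comp (loopClass G β) = ψ.comp (loopClass G β)) : φ = ψ := by
  obtain ⟨b, β, hβ⟩ := exists_loopHom_factorization (Y := Y) G
  let φ' : (chains Y G).homology 1 ⟶ AddCommGrpCat.of A := AddCommGrpCat.ofHom φ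
  let ψ' : (chains Y G).homology 1 ⟶ AddCommGrpCat.of A := AddCommGrpCat.ofHom ψ
  suffices φ' = ψ' from congrArg AddCommGrpCat.Hom.hom this
  rw [← cancel_epi ((chains Y G).homologyπ 1), ← hβ, Category.assoc, Category.assoc]
  refine congrArg _ (SSet.chainComplex_hom_ext fun σ => ?_)
  rw [← Category.assoc, ← Category.assoc, ι_chainDesc]
  exact congrArg AddCommGrpCat.ofHom (h (β σ))

theorem hOneMap_comp_loopClass {Z : Type u} [TopologicalSpace Z] (f : C(Y, Z)) (β : Path x x) :
    (hOneMap G f).comp (loopClass G β) = loopClass G (β.map f.continuous) := by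
  let φ : chains Y G ⟶ chains Z G :=
    SSet.chainComplexMap (TopCat.toSSet.map (TopCat.ofHom f)) (AddCommGrpCat.of G)
  have h : loopHom G β ≫ HomologicalComplex.homologyMap φ 1 = loopHom G (β.map f.continuous) := by
    rw [← cancel_mono ((chains Z G).homologyι 1), Category.assoc,
      HomologicalComplex.homologyι_naturality, ← Category.assoc, loopHom_homologyι,
      loopHom_homologyι, pathClass, Category.assoc, HomologicalComplex.p_opcyclesMap,
      ← Category.assoc, SSet.ι_chainComplexMap_f]
    rfl
  exact congrArg AddCommGrpCat.Hom.hom h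

end Homology

section HOneRips

open Realization

variable {X : Type u} [MetricSpace X] {G : Type u} [AddCommGroup G] {r : Set.Ioi (0 : ℝ)}

theorem loopClass_eq_of_comp_eq_comp {Y : Type u} [TopologicalSpace Y] {x y : Y} {β : Path x x}
    {δ : Path y y} (e : FundamentalGroupoid.mk x ⟶ FundamentalGroupoid.mk y)
    (h : e ≫ pathArrow δ = pathArrow β ≫ e) : loopClass G β = loopClass G δ := by
  obtain ⟨H, hH⟩ := exists_hurewiczCocycle (Y := Y) G
  have eval_eq := congrArg H.eval h
  rw [H.eval_comp, H.eval_comp, hH, hH, add_comm] at eval_eq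
  exact (add_right_cancel eval_eq).symm

theorem loopClass_refl {Y : Type u} [TopologicalSpace Y] (y : Y) :
    loopClass G (Path.refl y) = 0 := by
  obtain ⟨H, hH⟩ := exists_hurewiczCocycle (Y := Y) G
  rw [← hH, pathArrow_refl, H.eval_id]

theorem exists_pathArrow_eq_ripsFunctor_map [PathConnectedSpace X] {x : X} (β : Path x x) :
    ∃ δ : Path (vertex (rips X r) x) (vertex (rips X r) x),
      (ripsFunctor r).map (pathArrow β) = pathArrow δ := by
  obtain ⟨δ, hδ⟩ := pathArrow_surjective ((ripsFunctor r).map (pathArrow β))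
  exact ⟨δ, hδ.symm⟩

theorem exists_hOneRips [PathConnectedSpace X] :
    ∃ θ : HOne G X →+ HOne G (Realization (rips X r)),
      ∀ {x : X} {β : Path x x} {δ : Path (vertex (rips X r) x) (vertex (rips X r) x)},
        (ripsFunctor r).map (pathArrow β) = pathArrow δ →
          θ.comp (loopClass G β) = loopClass G δ := by
  obtain ⟨H, hH⟩ := exists_hurewiczCocycle (Y := Realization (rips X r)) G
  obtain ⟨θ, hθ⟩ := exists_hOne_hom_of_cocycle (Y := X) G (ripsFunctor r ⋙ H)
  refine ⟨θ, fun {x β δ} h => ?_⟩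
  rw [hθ, ← hH, ← h]
  rfl

section

variable [PathConnectedSpace X]

variable (G r) in
/-- The homomorphism from the first homology of a space to that of its Rips complex, induced by
the functor `ripsFunctor` between the fundamental groupoids. -/
noncomputable def hOneRips : HOne G X →+ HOne G (Realization (rips X r)) :=
  exists_hOneRips.choose

theorem hOneRips_comp_loopClass {x : X} {β : Path x x}
    {δ : Path (vertex (rips X r) x) (vertex (rips X r) x)}
    (h : (ripsFunctor r).map (pathArrow β) = pathArrow δ) :
    (hOneRips G r).comp (loopClass G β) = loopClass G δ :=
  exists_hOneRips.choose_spec h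

theorem hOneMap_comp_hOneRips {p q : Set.Ioi (0 : ℝ)} (hpq : p ≤ q) :
    (hOneMap G (incl (rips_mono hpq))).comp (hOneRips G p) =
      hOneRips (X := X) G q := by
  refine hOne_hom_ext fun {x} β => ?_
  obtain ⟨δ, hδ⟩ := exists_pathArrow_eq_ripsFunctor_map (r := p) β
  have map_δ : (ripsFunctor q).map (pathArrow β) =
      pathArrow (δ.map (incl (rips_mono hpq)).continuous) := by
    rw [← map_incl_ripsFunctor_map hpq, hδ]
    rfl
  rw [AddMonoidHom.comp_assoc, hOneRips_comp_loopClass hδ, hOneMap_comp_loopClass]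
  exact (hOneRips_comp_loopClass map_δ).symm

variable (hX : IsGeodesicSpace X)

include hX

theorem hOneRips_surjective : Function.Surjective (hOneRips (X := X) G r) := by
  rw [← AddMonoidHom.range_eq_top, ← QuotientAddGroup.ker_mk' (hOneRips G r).range,
    AddMonoidHom.ker_eq_top_iff]
  refine hOne_hom_ext fun {u} δ => ?_
  obtain ⟨q, hq⟩ := exists_ripsFunctor_map_eq_of_support hX (pathArrow δ) _ _
    u.someVertex_mem u.someVertex_mem
  obtain ⟨β, rfl⟩ := pathArrow_surjective q
  obtain ⟨δ', hδ'⟩ := exists_pathArrow_eq_ripsFunctor_map (r := r) β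
  rw [hδ'] at hq
  rw [loopClass_eq_of_comp_eq_comp _ hq, ← hOneRips_comp_loopClass hδ']
  ext g
  exact (QuotientAddGroup.eq_zero_iff _).2 ⟨_, rfl⟩

theorem diamHOne_le_ker : diamHOne X G (3 * r.1 / 2) ≤ (hOneRips G r).ker := by
  refine (AddSubgroup.closure_le _).2 ?_
  rintro _ ⟨x, β, g, hβ, rfl⟩
  have β_trivial := ripsFunctor_map_eq_id_of_range_subset_ball (r := r) hX β
    (range_subset_ball_of_diam_lt β hβ)
  have comp_loopClass := hOneRips_comp_loopClass (G := G) (δ := Path.refl _)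
    (β_trivial.trans (pathArrow_refl _).symm)
  rw [loopClass_refl] at comp_loopClass
  exact DFunLike.congr_fun comp_loopClass g

theorem ker_le_diamHOne : (hOneRips G r).ker ≤ diamHOne X G (3 * r.1 / 2) := by
  let π := QuotientAddGroup.mk' (diamHOne X G (3 * r.1 / 2))
  obtain ⟨H, hH⟩ := exists_hurewiczCocycle (Y := X) G
  obtain ⟨W, hW⟩ := exists_ripsFunctor_extension hX (r := r)
    (T := H ⋙ (AddMonoidHom.toMultiplicative (AddMonoidHom.compHom π)).toFunctor)
    fun x β hβ => by
      refine congrArg Multiplicative.ofAdd (AddMonoidHom.ext fun g => ?_)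
      exact (QuotientAddGroup.eq_zero_iff _).2
        (AddSubgroup.subset_closure ⟨x, β, g, hβ, DFunLike.congr_fun (hH β) g⟩)
  obtain ⟨Φ, hΦ⟩ := exists_hOne_hom_of_cocycle G W
  have Φ_comp : Φ.comp (hOneRips G r) = π := by
    refine hOne_hom_ext fun {x} β => ?_
    obtain ⟨δ, hδ⟩ := exists_pathArrow_eq_ripsFunctor_map (r := r) β
    rw [AddMonoidHom.comp_assoc, hOneRips_comp_loopClass hδ, hΦ, ← hδ, ← hH]
    exact congrArg Multiplicative.toAdd (hW _)
  intro c hc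
  refine (QuotientAddGroup.eq_zero_iff c).1 ((DFunLike.congr_fun Φ_comp c).symm.trans ?_)
  rw [AddMonoidHom.comp_apply, AddMonoidHom.mem_ker.1 hc, map_zero]

variable (G) in
/-- The isomorphism from the first homology of the Rips complex to the quotient of the first
homology of `X` by the classes of loops of small diameter. -/
noncomputable def hOneRipsEquiv (r : Set.Ioi (0 : ℝ)) :
    HOne G (Realization (rips X r)) ≃+ HOne G X ⧸ diamHOne X G (3 * r.1 / 2) :=
  ((QuotientAddGroup.quotientAddEquivOfEq
    ((diamHOne_le_ker hX).antisymm (ker_le_diamHOne hX))).trans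
    (QuotientAddGroup.quotientKerEquivOfSurjective _ (hOneRips_surjective hX))).symm

theorem hOneRipsEquiv_hOneRips (c : HOne G X) :
    hOneRipsEquiv G hX r (hOneRips G r c) = QuotientAddGroup.mk c :=
  (AddEquiv.symm_apply_eq _).2 rfl

end

theorem subsingleton_hOne {Y : Type u} [TopologicalSpace Y] [IsEmpty Y] :
    Subsingleton (HOne G Y) :=
  subsingleton_of_forall_eq 0 fun c => DFunLike.congr_fun
    (hOne_hom_ext (φ := AddMonoidHom.id (HOne G Y)) (ψ := 0) fun {x} _ => (IsEmpty.false x).elim) c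

variable (G) in
theorem exists_hOneRipsEquiv (hX : IsGeodesicSpace X) :
    ∃ f : ∀ r : Set.Ioi (0 : ℝ),
        HOne G (Realization (rips X r)) ≃+ HOne G X ⧸ diamHOne X G (3 * r.1 / 2),
      ∀ (p q : Set.Ioi (0 : ℝ)) (hpq : p ≤ q) (c : HOne G (Realization (rips X p))),
        f q (hOneMap G (incl (rips_mono hpq)) c) =
          diamHOneProj X G (scale_mono hpq) (f p c) := by
  cases isEmpty_or_nonempty X
  · have (d : ℝ) : Subsingleton (HOne G X ⧸ diamHOne X G d) :=
      have := subsingleton_hOne (Y := X) (G := G)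
      (QuotientAddGroup.mk'_surjective _).subsingleton
    have (r : Set.Ioi (0 : ℝ)) : Subsingleton (HOne G (Realization (rips X r))) :=
      have : IsEmpty (Realization (rips X r)) := ⟨fun u => isEmptyElim u.someVertex⟩
      subsingleton_hOne
    exact ⟨fun r => AddEquiv.ofBijective (0 : _ →+ _)
      ⟨Function.injective_of_subsingleton _, Function.surjective_to_subsingleton _⟩,
      fun p q hpq c => Subsingleton.elim _ _⟩
  · have : PathConnectedSpace X := hX.pathConnectedSpace
    refine ⟨hOneRipsEquiv G hX, fun p q hpq c => ?_⟩
    obtain ⟨a, rfl⟩ := hOneRips_surjective hX c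
    have incl_a := DFunLike.congr_fun (hOneMap_comp_hOneRips (G := G) hpq) a
    rw [AddMonoidHom.comp_apply] at incl_a
    rw [incl_a, hOneRipsEquiv_hOneRips, hOneRipsEquiv_hOneRips]
    rfl

end HOneRips

end RipsPersistence

theorem mainTheorem7 {X : Type u} [MetricSpace X] (hX : RipsPersistence.IsGeodesicSpace X) :
    (∀ x₀ : X,
      ∃ f : ∀ r : Set.Ioi (0 : ℝ),
          FundamentalGroup (RipsPersistence.Realization (RipsPersistence.rips X r))
              (RipsPersistence.Realization.vertex (RipsPersistence.rips X r) x₀) ≃*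
            FundamentalGroup X x₀ ⧸ RipsPersistence.diamPiOne x₀ (3 * r.1 / 2),
        ∀ (p q : Set.Ioi (0 : ℝ)) (hpq : p ≤ q)
          (c : FundamentalGroup (RipsPersistence.Realization (RipsPersistence.rips X p))
            (RipsPersistence.Realization.vertex (RipsPersistence.rips X p) x₀)),
          f q (RipsPersistence.piOneIncl (RipsPersistence.rips_mono hpq) x₀ c) =
            RipsPersistence.diamPiOneProj x₀ (RipsPersistence.scale_mono hpq) (f p c)) ∧
    (∀ (G : Type u) [AddCommGroup G],
      ∃ f : ∀ r : Set.Ioi (0 : ℝ),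
          RipsPersistence.HOne G (RipsPersistence.Realization (RipsPersistence.rips X r)) ≃+
            RipsPersistence.HOne G X ⧸ RipsPersistence.diamHOne X G (3 * r.1 / 2),
        ∀ (p q : Set.Ioi (0 : ℝ)) (hpq : p ≤ q)
          (c : RipsPersistence.HOne G
            (RipsPersistence.Realization (RipsPersistence.rips X p))),
          f q (RipsPersistence.hOneMap G
              (RipsPersistence.Realization.incl (RipsPersistence.rips_mono hpq)) c) =
            RipsPersistence.diamHOneProj X G (RipsPersistence.scale_mono hpq) (f p c)) :=
  ⟨fun x₀ => RipsPersistence.exists_piOneRipsEquiv hX x₀,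
    fun G _ => RipsPersistence.exists_hOneRipsEquiv G hX⟩
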